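/- Let $G$ and $H$ be finitely generated groups with word metrics given by finite generating sets $S_0\subseteq G$ and $T_0\subseteq H$, and let $\mathcal P$ and $\mathcal Q$ be finite collections of infinite subgroups of $G$ and $H$ respectively. Write $G/\mathcal P$ for the set of left cosets $gP$ with $g\in G$, $P\in\mathcal P$, and similarly $H/\mathcal Q$. Let $q\colon (G,\mathcal P)\to(H,\mathcal Q)$ be a quasi-isometry of pairs; that is, $q\colon G\to H$ is a quasi-isometry and there is $M>0$ such that every $A\in G/\mathcal P$ has some $B\in H/\mathcal Q$, and every $B\in H/\mathcal Q$ has some $A\in G/\mathcal P$, for which the Hausdorff distance in $H$ between $q(A)$ and $B$ is less than $M$. Let $\bar q\colon H\to G$ be a quasi-inverse of $q$. Let $T\subseteq H$ be a (possibly infinite) generating set such that the quasi-action of $G$ on $H$ induced by $q$ is uniform with respect to $T$; that is, there are $L\ge 1$ and $C\ge 0$ such that for every $g\in G$ the map $q_g\colon H\to H$, $q_g(h)=q(g\cdot\bar q(h))$, is an $(L,C)$-quasi-isometry for the word metric on $H$ given by $T$ (the metric of the Cayley graph $\Gamma(H,T)$). Let $\mathcal P^*$ be a refinement of $\mathcal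 P$, that is, a set of representatives of the conjugacy classes of the collection of subgroups $\{\mathrm{Comm}_G(gPg^{-1}) : P\in\mathcal P,\ g\in G\}$, where $\mathrm{Comm}_G(K)$ denotes the commensurator of $K$ in $G$. If $\mathcal Q$ is hyperbolically embedded in $H$ with respect to $T$, written $\mathcal Q\hookrightarrow_h(H,T)$, then $\mathcal P^*\hookrightarrow_h G$; that is, there is a subset $X\subseteq G$ with $\mathcal P^*\hookrightarrow_h(G,X)$. Here, for a collection $\mathcal P$ of subgroups of a group $G$ and a subset $X\subseteq G$, $\mathcal P\hookrightarrow_h(G,X)$ means that $X\cup\bigcup_{P\in\mathcal P}P$ generates $G$, that the Cayley graph $\Gamma$ of $G$ with respect to the disjoint union of $X$ and all $P\in\mathcal P$ is hyperbolic, and that for each $P\in\mathcal P$ every ball of finite radius in $(P,\hat d_P)$ is finite. Here $\hat d_P(g,h)\in[0,\infty]$ is the length of a shortest path in $\Gamma$ from $g$ to $h$ that contains no edge joining two elements of $P$ and labelled by a letter of $P$. -/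

import Mathlib

open scoped Pointwise

/-! Quasi-isometries between (vertex sets of) connected graphs, with the path metric. -/

/-- `f` is an `(L, C)`-quasi-isometry from the vertex set of `Γ` to the vertex set of `Δ`, both with
the path metric `SimpleGraph.dist`. Only used for connected graphs. -/
structure IsQuasiIsometryWith {X Y : Type*} (Γ : SimpleGraph X) (Δ : SimpleGraph Y)
    (L C : ℝ) (f : X → Y) : Prop where
  one_le : 1 ≤ L
  nonneg : 0 ≤ C
  upper : ∀ x x' : X, (Δ.dist (f x) (f x') : ℝ) ≤ L * (Γ.dist x x' : ℝ) + C
  lower : ∀ x x' : X, (Γ.dist x x' : ℝ) / L - C ≤ (Δ.dist (f x) (f x') : ℝ)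
  coarse_surj : ∀ y : Y, ∃ x : X, (Δ.dist (f x) y : ℝ) ≤ C

/-- `f` is a quasi-isometry. -/
def IsQuasiIsometry {X Y : Type*} (Γ : SimpleGraph X) (Δ : SimpleGraph Y) (f : X → Y) : Prop :=
  ∃ L C : ℝ, IsQuasiIsometryWith Γ Δ L C f

/-- `f'` is a quasi-inverse of `f`: a quasi-isometry in the other direction such that `f' ∘ f` and
`f ∘ f'` are at finite distance from the identity maps. -/
def IsQuasiInverse {X Y : Type*} (Γ : SimpleGraph X) (Δ : SimpleGraph Y)
    (f : X → Y) (f' : Y → X) : Prop :=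
  IsQuasiIsometry Δ Γ f' ∧
    ∃ C : ℝ, (∀ x : X, (Γ.dist (f' (f x)) x : ℝ) ≤ C) ∧ ∀ y : Y, (Δ.dist (f (f' y)) y : ℝ) ≤ C

/-- The Hausdorff distance, with values in `ℕ∞`, between two sets of vertices of a graph. -/
noncomputable def graphHausdorffDist {Y : Type*} (Δ : SimpleGraph Y) (A B : Set Y) : ℕ∞ :=
  max (⨆ a ∈ A, ⨅ b ∈ B, Δ.edist a b) (⨆ b ∈ B, ⨅ a ∈ A, Δ.edist a b)

/-! Collections of subgroups. -/

/-- `G / Ps`: the set of all left cosets `gP` with `g ∈ G` and `P ∈ Ps`, as subsets of `G`. -/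
def cosetCollection {G : Type*} [Group G] (Ps : Set (Subgroup G)) : Set (Set G) :=
  {A | ∃ g : G, ∃ P ∈ Ps, A = g • (P : Set G)}

/-- `q : (G, Ps) → (H, Qs)` is a quasi-isometry of pairs, for the word metrics on `G` and `H` given
by the generating sets `S` and `T`. As word metrics are integer valued, the bound `M` may be taken
to be a natural number. -/
def IsQuasiIsometryOfPairs {G H : Type*} [Group G] [Group H] (S : Set G) (T : Set H)
    (Ps : Set (Subgroup G)) (Qs : Set (Subgroup H)) (q : G → H) : Prop :=
  IsQuasiIsometry (SimpleGraph.mulCayley S) (SimpleGraph.mulCayley T) q ∧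
    ∃ M : ℕ,
      (∀ A ∈ cosetCollection Ps, ∃ B ∈ cosetCollection Qs,
        graphHausdorffDist (SimpleGraph.mulCayley T) (q '' A) B < (M : ℕ∞)) ∧
      (∀ B ∈ cosetCollection Qs, ∃ A ∈ cosetCollection Ps,
        graphHausdorffDist (SimpleGraph.mulCayley T) (q '' A) B < (M : ℕ∞))

/-- The quasi-action of `G` on `H` induced by `q : G → H` with quasi-inverse `q'` is uniform with
respect to `T`: the maps `q_g : h ↦ q (g * q' h)`, for `g ∈ G`, are `(L, C)`-quasi-isometries of the
Cayley graph `Γ(H, T)` for constants `L` and `C` that do not depend on `g`. -/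
def InducesUniformQuasiAction {G H : Type*} [Group G] [Group H] (T : Set H)
    (q : G → H) (q' : H → G) : Prop :=
  ∃ L C : ℝ, ∀ g : G,
    IsQuasiIsometryWith (SimpleGraph.mulCayley T) (SimpleGraph.mulCayley T) L C
      (fun h => q (g * q' h))

/-- `{Comm_G(gPg⁻¹) : P ∈ Ps, g ∈ G}`. -/
def commensuratorCollection {G : Type*} [Group G] (Ps : Set (Subgroup G)) : Set (Subgroup G) :=
  {K | ∃ P ∈ Ps, ∃ g : G, K = Subgroup.Commensurable.commensurator (MulAut.conj g • P)}

/-- `Pstar` is a refinement of `Ps`: a set of representatives of the conjugacy classes of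
`{Comm_G(gPg⁻¹) : P ∈ Ps, g ∈ G}`. -/
def IsRefinement {G : Type*} [Group G] (Ps Pstar : Set (Subgroup G)) : Prop :=
  Pstar ⊆ commensuratorCollection Ps ∧
    ∀ K ∈ commensuratorCollection Ps, ∃! R : Subgroup G, R ∈ Pstar ∧ ∃ g : G, MulAut.conj g • K = R

/-! Hyperbolicity and hyperbolically embedded collections. -/

/-- A connected graph is hyperbolic: geodesic triangles are uniformly slim. -/
def IsHyperbolicGraph {X : Type*} (Γ : SimpleGraph X) : Prop :=
  Γ.Connected ∧ ∃ δ : ℕ, ∀ (x y z : X) (a : Γ.Walk x y) (b : Γ.Walk y z) (c : Γ.Walk x z),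
    a.length = Γ.dist x y → b.length = Γ.dist y z → c.length = Γ.dist x z →
      ∀ u ∈ a.support, ∃ v, (v ∈ b.support ∨ v ∈ c.support) ∧ Γ.dist u v ≤ δ

/-- The graph obtained from the Cayley graph of `G` with respect to the disjoint union of `X` and
all `Q ∈ Ps` by removing the edges of the Cayley graph of `P` with respect to `P`, that is, the edges
between elements of `P` that are labelled by elements of the letter set `P`. Edges between elements
of `P` that are labelled by elements of `X`, or of some `Q ∈ Ps` other than `P`, are kept. (Loops and
multiple edges do not matter for lengths of shortest paths.) -/
def relativeCayleyGraph {G : Type*} [Group G] (Ps : Set (Subgroup G)) (X : Set G)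
    (P : Subgroup G) : SimpleGraph G :=
  SimpleGraph.fromRel fun g h =>
    g⁻¹ * h ∈ X ∨ ∃ Q ∈ Ps, g⁻¹ * h ∈ Q ∧ ¬ (Q = P ∧ g ∈ P ∧ h ∈ P)

/-- `Ps ↪_h (G, X)`: the collection `Ps` is hyperbolically embedded in `G` with respect to `X`
(Dahmani–Guirardel–Osin). The union of `X` and of the subgroups in `Ps` generates `G`, the
corresponding Cayley graph is hyperbolic, and each `P ∈ Ps` is locally finite for its relative
metric: the distance between two elements of `P` is the length of a shortest path between them in
`relativeCayleyGraph Ps X P` (infinite if there is none). -/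
def IsHypEmbeddedWrt {G : Type*} [Group G] (Ps : Set (Subgroup G)) (X : Set G) : Prop :=
  Subgroup.closure (X ∪ ⋃ P ∈ Ps, (P : Set G)) = ⊤ ∧
    IsHyperbolicGraph (SimpleGraph.mulCayley (X ∪ ⋃ P ∈ Ps, (P : Set G))) ∧
    ∀ P ∈ Ps, ∀ g ∈ P, ∀ n : ℕ,
      {h : G | h ∈ P ∧ (relativeCayleyGraph Ps X P).edist g h ≤ (n : ℕ∞)}.Finite

/-- `Ps ↪_h G`: the collection `Ps` is hyperbolically embedded in `G`. -/
def IsHypEmbedded {G : Type*} [Group G] (Ps : Set (Subgroup G)) : Prop :=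
  ∃ X : Set G, IsHypEmbeddedWrt Ps X

/-! ### Metric estimates in connected graphs -/

namespace SimpleGraph

variable {V W : Type*} {Γ : SimpleGraph V} {Δ : SimpleGraph W}

/-! The letter set on `G` is pulled back from `T`: let `X` consist of all `x` such that `q g` and `q
(g * x)` are `N`-close in `Γ(H, T)` for every `g`. For large `N` it contains `S₀`, and uniformity of
the quasi-action puts every `(q' h)⁻¹ * q' h'` with `h⁻¹ * h' ∈ T` into it. Hence `q` and `q'`
stretch `X`-edges and `T`-edges by a bounded amount.

Cosets are compared up to finite Hausdorff distance. Distinct cosets of `Qs` are never at finite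
distance: otherwise any two points of the infinite coset `B` would be joined by a bounded detour
through the other coset, against local finiteness of the relative metric
(`IsHypEmbeddedWrt.coset_eq_of_coarseEq`). Through `q`, cosets of `Ps` at finite distance are
therefore uniformly close. As `Comm(gPg⁻¹)` is the stabilizer of the coarse class of `gP`, this
uniformity keeps it at finite distance from `gP`. So cosets of `Pstar` represent the same coarse
classes as those of `Ps`, but each class only once (`IsRefinement.eq_of_coarseEq`), and distinct
ones correspond to distinct cosets of `Qs`.

Now `q` is a quasi-isometric embedding of the Cayley graphs that include the peripheral letters, and
hyperbolicity pulls back by stability of quasi-geodesics. A path avoiding the edges of `P` maps to a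
coarse path avoiding the edges of the matching coset `B`; finiteness of balls in `B` and properness
of `q` for the finite word metrics give local finiteness
(`isHypEmbeddedWrt_of_coarse_correspondence`). -/

theorem Connected.dist_map_le (hΓ : Γ.Connected) (hΔ : Δ.Connected) {f : V → W} {K : ℕ}
    (h : ∀ x y, Γ.Adj x y → Δ.dist (f x) (f y) ≤ K) (x y : V) :
    Δ.dist (f x) (f y) ≤ K * Γ.dist x y := by
  have key : ∀ {x y : V} (w : Γ.Walk x y), Δ.dist (f x) (f y) ≤ K * w.length := by
    intro x y w
    induction w with
    | nil => simp
    | @cons a b c hab w ih =>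
      have h1 := h _ _ hab
      have h2 := hΔ.dist_triangle (u := f a) (v := f b) (w := f c)
      rw [Walk.length_cons, mul_add]
      omega
  obtain ⟨w, hw⟩ := hΓ.exists_walk_length_eq_dist x y
  rw [← hw]
  exact key w

theorem edist_map_le {f : V → W} {K : ℕ}
    (h : ∀ x y, Γ.Adj x y → Δ.edist (f x) (f y) ≤ K) {x y : V} {n : ℕ} (hxy : Γ.edist x y ≤ n) :
    Δ.edist (f x) (f y) ≤ (K * n : ℕ) := by
  have key : ∀ {x y : V} (w : Γ.Walk x y), Δ.edist (f x) (f y) ≤ (K * w.length : ℕ) := by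
    intro x y w
    induction w with
    | nil => simp
    | @cons a b c hab w ih =>
      refine Δ.edist_triangle.trans ((add_le_add (h _ _ hab) ih).trans ?_)
      rw [Walk.length_cons, mul_add, ← Nat.cast_add]
      exact Nat.cast_le.2 (by omega)
  obtain ⟨w, hw⟩ := Γ.exists_walk_of_edist_ne_top (ne_top_of_le_ne_top (ENat.natCast_ne_top n) hxy)
  refine (key w).trans (Nat.cast_le.2 ?_)
  rw [← hw, Nat.cast_le] at hxy
  exact Nat.mul_le_mul_left _ hxy

/-- The union of all geodesics from `x` to `y`. -/
def interval (Γ : SimpleGraph V) (x y : V) : Set V :=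
  {u | Γ.dist x u + Γ.dist u y = Γ.dist x y}

theorem mem_interval {x y u : V} :
    u ∈ Γ.interval x y ↔ Γ.dist x u + Γ.dist u y = Γ.dist x y := Iff.rfl

theorem interval_comm (x y : V) : Γ.interval x y = Γ.interval y x := by
  ext u
  rw [mem_interval, mem_interval, Γ.dist_comm (u := x), Γ.dist_comm (v := y),
    Γ.dist_comm (u := x), add_comm]

theorem left_mem_interval (x y : V) : x ∈ Γ.interval x y := by simp [mem_interval]

theorem Walk.mem_interval_of_mem_support {x y u : V} (hΓ : Γ.Connected) (p : Γ.Walk x y)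
    (hp : p.length = Γ.dist x y) (hu : u ∈ p.support) : u ∈ Γ.interval x y := by
  classical
  have h := congrArg Walk.length (p.take_spec hu)
  rw [Walk.length_append] at h
  have h1 := dist_le (p.takeUntil u hu)
  have h2 := dist_le (p.dropUntil u hu)
  have h3 := hΓ.dist_triangle (u := x) (v := u) (w := y)
  rw [mem_interval]
  omega

theorem Connected.exists_geodesic_through (hΓ : Γ.Connected) {x y u : V}
    (hu : u ∈ Γ.interval x y) :
    ∃ p : Γ.Walk x y, p.length = Γ.dist x y ∧ u ∈ p.support := by
  obtain ⟨p, hp⟩ := hΓ.exists_walk_length_eq_dist x u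
  obtain ⟨r, hr⟩ := hΓ.exists_walk_length_eq_dist u y
  refine ⟨p.append r, ?_, ?_⟩
  · rw [Walk.length_append, hp, hr]
    exact hu
  · simp

theorem Walk.exists_mem_support_dist_eq {x y : V} (hΓ : Γ.Connected) (p : Γ.Walk x y)
    (hp : p.length = Γ.dist x y) {k : ℕ} (hk : k ≤ Γ.dist x y) :
    ∃ u ∈ p.support, Γ.dist x u = k := by
  refine ⟨p.getVert k, p.getVert_mem_support k, ?_⟩
  have h1 := dist_le (p.take k)
  have h2 := dist_le (p.drop k)
  rw [Walk.take_length] at h1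
  rw [Walk.drop_length] at h2
  have h3 := hΓ.dist_triangle (u := x) (v := p.getVert k) (w := y)
  omega

theorem Connected.exists_mem_interval_dist_eq (hΓ : Γ.Connected) {x y : V} {k : ℕ}
    (hk : k ≤ Γ.dist x y) : ∃ u ∈ Γ.interval x y, Γ.dist x u = k := by
  obtain ⟨p, hp⟩ := hΓ.exists_walk_length_eq_dist x y
  obtain ⟨u, hu, h⟩ := p.exists_mem_support_dist_eq hΓ hp hk
  exact ⟨u, p.mem_interval_of_mem_support hΓ hp hu, h⟩

/-- Geodesic triangles, with sides replaced by unions of all geodesics, are `δ`-slim. -/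
def HasSlimIntervals (Γ : SimpleGraph V) (δ : ℕ) : Prop :=
  ∀ x y z, ∀ u ∈ Γ.interval x y, ∃ v, (v ∈ Γ.interval x z ∨ v ∈ Γ.interval z y) ∧ Γ.dist u v ≤ δ

/-- Slimness of the degenerate triangle `x`, `y`, `v`: the point of its other two sides near `u` is
forced to be `δ`-close to `v` by comparing distances to `x` or to `y`. -/
theorem HasSlimIntervals.dist_le_of_dist_eq {δ : ℕ} (hΓ : Γ.Connected) (h : Γ.HasSlimIntervals δ)
    {x y u v : V} (hu : u ∈ Γ.interval x y) (hv : v ∈ Γ.interval x y)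
    (huv : Γ.dist x u = Γ.dist x v) : Γ.dist u v ≤ 2 * δ := by
  obtain ⟨w, hw, hd⟩ := h x y v u hu
  have t1 := hΓ.dist_triangle (u := x) (v := w) (w := u)
  have t2 := hΓ.dist_triangle (u := u) (v := w) (w := y)
  have t3 := hΓ.dist_triangle (u := u) (v := w) (w := v)
  have c1 := Γ.dist_comm (u := w) (v := u)
  have c2 := Γ.dist_comm (u := w) (v := v)
  simp only [mem_interval] at hu hv hw
  omega

/-- Intervals turn arguments about walks into arithmetic of distances. Returning to prescribed
geodesics costs `2 * δ`, by moving to the point of the chosen side at the same distance from its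
origin. -/
theorem isHyperbolicGraph_iff :
    IsHyperbolicGraph Γ ↔ Γ.Connected ∧ ∃ δ, Γ.HasSlimIntervals δ := by
  constructor
  · rintro ⟨hΓ, δ, h⟩
    refine ⟨hΓ, δ, fun x y z u hu => ?_⟩
    obtain ⟨a, ha, hua⟩ := hΓ.exists_geodesic_through hu
    obtain ⟨b, hb⟩ := hΓ.exists_walk_length_eq_dist y z
    obtain ⟨c, hc⟩ := hΓ.exists_walk_length_eq_dist x z
    obtain ⟨v, hv, hd⟩ := h x y z a b c ha hb hc u hua
    refine ⟨v, ?_, hd⟩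
    rcases hv with hv | hv
    · right
      rw [interval_comm]
      exact b.mem_interval_of_mem_support hΓ hb hv
    · left
      exact c.mem_interval_of_mem_support hΓ hc hv
  · rintro ⟨hΓ, δ, h⟩
    refine ⟨hΓ, δ + 2 * δ, fun x y z a b c ha hb hc u hu => ?_⟩
    obtain ⟨v, hv, hd⟩ := h x y z u (a.mem_interval_of_mem_support hΓ ha hu)
    have aux : ∀ {s t : V} (p : Γ.Walk s t), p.length = Γ.dist s t → v ∈ Γ.interval s t →
        ∃ w ∈ p.support, Γ.dist u w ≤ δ + 2 * δ := by
      intro s t p hp hv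
      obtain ⟨w, hw, hk⟩ := p.exists_mem_support_dist_eq hΓ hp (k := Γ.dist s v)
        (by rw [mem_interval] at hv; omega)
      refine ⟨w, hw, hΓ.dist_triangle.trans (add_le_add hd ?_)⟩
      exact h.dist_le_of_dist_eq hΓ hv (p.mem_interval_of_mem_support hΓ hp hw) hk.symm
    rcases hv with hv | hv
    · obtain ⟨w, hw, h⟩ := aux c hc hv
      exact ⟨w, Or.inr hw, h⟩
    · rw [interval_comm] at hv
      obtain ⟨w, hw, h⟩ := aux b hb hv
      exact ⟨w, Or.inl hw, h⟩

/-! ### Stability of quasi-geodesics -/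

/-- Bisection: each halving of the chain costs one slim triangle, so the error is logarithmic in the
number of steps. -/
theorem HasSlimIntervals.exists_dist_le_of_chain {δ K : ℕ} (hΓ : Γ.Connected)
    (h : Γ.HasSlimIntervals δ) {p : ℕ → V} :
    ∀ N a b : ℕ, a ≤ b → b - a ≤ 2 ^ N →
      (∀ i, a ≤ i → i < b → Γ.dist (p i) (p (i + 1)) ≤ K) → ∀ w ∈ Γ.interval (p a) (p b),
      ∃ i, a ≤ i ∧ i ≤ b ∧ Γ.dist w (p i) ≤ δ * N + K := by
  intro N
  induction N with
  | zero =>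
    intro a b hab hN hp w hw
    refine ⟨a, le_rfl, hab, ?_⟩
    rw [mem_interval] at hw
    have c := Γ.dist_comm (u := w) (v := p a)
    rcases Nat.eq_or_lt_of_le hab with rfl | hlt
    · have : Γ.dist (p a) (p a) = 0 := dist_self
      omega
    · obtain rfl : b = a + 1 := by simp at hN; omega
      have := hp a le_rfl (by omega)
      omega
  | succ N ih =>
    intro a b hab hN hp w hw
    rw [pow_succ] at hN
    obtain ⟨v, hv, hd⟩ := h _ _ (p ((a + b) / 2)) w hw
    have t := fun i => hΓ.dist_triangle (u := w) (v := v) (w := p i)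
    rcases hv with hv | hv
    · obtain ⟨i, h1, h2, h3⟩ := ih a ((a + b) / 2) (by omega) (by omega)
        (fun i hi hi' => hp i hi (by omega)) v hv
      exact ⟨i, h1, by omega, by have := t i; rw [mul_add]; omega⟩
    · obtain ⟨i, h1, h2, h3⟩ := ih ((a + b) / 2) b (by omega) (by omega)
        (fun i hi hi' => hp i (by omega) hi') v hv
      exact ⟨i, by omega, h2, by have := t i; rw [mul_add]; omega⟩

end SimpleGraph

/-! ### Numerical bounds: exponential against linear growth -/

theorem Nat.exists_forall_linear_le_two_pow (a b : ℕ) : ∃ N₀, ∀ N ≥ N₀, a * N + b ≤ 2 ^ N := by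
  refine ⟨a + b + 4, fun N hN => ?_⟩
  have h1 : ∀ n : ℕ, (n + 4) ^ 2 ≤ 2 ^ (n + 4) := by
    intro n
    induction n with
    | zero => norm_num
    | succ n ih =>
      rw [show n + 1 + 4 = (n + 4) + 1 by ring, pow_succ 2]
      refine le_trans ?_ (Nat.mul_le_mul_right 2 ih)
      rw [show (n + 4) ^ 2 * 2 = (n + 4 + 1) ^ 2 + (n ^ 2 + 6 * n + 7) by ring]
      exact Nat.le_add_right _ _
  obtain ⟨k, rfl⟩ : ∃ k, N = k + 4 := ⟨N - 4, by omega⟩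
  refine le_trans ?_ (h1 k)
  nlinarith

/-- A number bounded by the logarithm of a linear function of itself is bounded. The `N` tested is
about `(D - c) / (δ + 1)`: the premise is then linear in `N`, while its conclusion is too strong for
this `D`. -/
theorem Nat.exists_bound_of_log_bound (δ K c : ℕ) :
    ∃ D₀, ∀ D, (∀ N, 6 * K * D + K ≤ 2 ^ N → D ≤ c + δ * N) → D ≤ D₀ := by
  obtain ⟨N₀, hN₀⟩ := Nat.exists_forall_linear_le_two_pow (6 * K * (δ + 1))
    (6 * K * (c + δ + 1) + K)
  refine ⟨c + (δ + 1) * N₀, fun D hD => ?_⟩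
  by_contra! hlt
  set N := (D - c - 1) / (δ + 1) with hN
  have h1 : (δ + 1) * N ≤ D - c - 1 := Nat.mul_div_le _ _
  have h2 : D - c - 1 < (δ + 1) * N + (δ + 1) := by
    have := Nat.lt_mul_div_succ (D - c - 1) (Nat.succ_pos δ)
    rw [Nat.succ_eq_add_one, ← hN, mul_add, mul_one] at this
    exact this
  have h3 : N₀ ≤ N := by
    rw [hN, Nat.le_div_iff_mul_le (Nat.succ_pos δ), mul_comm]
    simp only [Nat.succ_eq_add_one]
    omega
  have h4 : D ≤ c + δ * N := by
    refine hD N (le_trans ?_ (hN₀ N h3))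
    have : D ≤ (δ + 1) * N + (c + δ + 1) := by omega
    calc 6 * K * D + K ≤ 6 * K * ((δ + 1) * N + (c + δ + 1)) + K := by gcongr
      _ = _ := by ring
  have h5 : δ * N ≤ (δ + 1) * N := Nat.mul_le_mul_right _ (by omega)
  omega

namespace SimpleGraph

variable {V W : Type*} {Γ : SimpleGraph V} {Δ : SimpleGraph W}

/-- The chain `p 0, …, p n` is a quasi-geodesic with constant `K`. -/
structure IsQuasiGeodesic (Γ : SimpleGraph V) (K n : ℕ) (p : ℕ → V) : Prop where
  step : ∀ i < n, Γ.dist (p i) (p (i + 1)) ≤ K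
  lower : ∀ i j, i ≤ j → j ≤ n → j - i ≤ K * Γ.dist (p i) (p j) + K

theorem IsQuasiGeodesic.dist_le {K n : ℕ} {p : ℕ → V} (hΓ : Γ.Connected)
    (hp : Γ.IsQuasiGeodesic K n p) (i j : ℕ) (hij : i ≤ j) (hj : j ≤ n) :
    Γ.dist (p i) (p j) ≤ K * (j - i) := by
  induction j, hij using Nat.le_induction with
  | base => simp
  | succ j hij ih =>
    have h1 := ih (by omega)
    have h2 := hp.step j (by omega)
    have h3 := hΓ.dist_triangle (u := p i) (v := p j) (w := p (j + 1))
    rw [Nat.succ_sub hij, Nat.succ_eq_add_one, mul_add]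
    omega

/-- Take `w` in the interval at the largest distance `D` from the chain. A quadrilateral around `w`
cuts out a piece of the chain with `O(D)` steps, to which bisection applies; hence `D` is `O(log
D)`. -/
theorem HasSlimIntervals.exists_dist_quasiGeodesic_le {δ : ℕ} (hΓ : Γ.Connected)
    (h : Γ.HasSlimIntervals δ) (K : ℕ) :
    ∃ D₀ : ℕ, ∀ (n : ℕ) (p : ℕ → V), Γ.IsQuasiGeodesic K n p →
      ∀ w ∈ Γ.interval (p 0) (p n), ∃ i ≤ n, Γ.dist w (p i) ≤ D₀ := by
  classical
  obtain ⟨D₀, hD₀⟩ := Nat.exists_bound_of_log_bound δ K (2 * δ + K)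
  refine ⟨D₀, fun n p hp => ?_⟩
  let P : ℕ → Prop := fun D => ∃ w ∈ Γ.interval (p 0) (p n), ∀ i ≤ n, D ≤ Γ.dist w (p i)
  have hP : ∀ D, P D → D ≤ Γ.dist (p 0) (p n) := by
    rintro D ⟨w, hw, h⟩
    have := h 0 (by omega)
    rw [mem_interval, Γ.dist_comm (u := p 0) (v := w)] at hw
    omega
  have hP0 : P 0 := ⟨p 0, left_mem_interval _ _, fun _ _ => Nat.zero_le _⟩
  set D := Nat.findGreatest P (Γ.dist (p 0) (p n)) with hD
  have hPD : P D := Nat.findGreatest_spec (Nat.zero_le _) hP0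
  have hmax : ∀ w ∈ Γ.interval (p 0) (p n), ∃ i ≤ n, Γ.dist w (p i) ≤ D := by
    intro w hw
    by_contra! hcon
    have h1 : P (D + 1) := ⟨w, hw, hcon⟩
    have := Nat.le_findGreatest (hP _ h1) h1
    omega
  suffices D ≤ D₀ by
    intro w hw
    obtain ⟨i, hi, h⟩ := hmax w hw
    exact ⟨i, hi, h.trans this⟩
  refine hD₀ D fun N hN => ?_
  obtain ⟨w, hw, hwp⟩ := hPD
  -- Go back from `w` by `2 * D`, or to `p 0` if that is nearer. By maximality `y` is `D`-close to
  -- some `p i`, and the interval between them stays at distance at least `D` from `w`. The point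
  -- `z` below is the same on the other side.
  obtain ⟨y, hyw, i, hi, hyi, hy, hwy⟩ : ∃ y, w ∈ Γ.interval y (p n) ∧ ∃ i ≤ n,
      Γ.dist y (p i) ≤ D ∧ Γ.dist w y ≤ 2 * D ∧
        (∀ v ∈ Γ.interval y (p i), D ≤ Γ.dist w v) := by
    by_cases hc : Γ.dist w (p 0) ≤ 2 * D
    · refine ⟨p 0, hw, 0, by omega, by simp, hc, fun v hv => ?_⟩
      have : v = p 0 := by
        rw [mem_interval, dist_self, Nat.add_eq_zero_iff] at hv
        exact (hΓ.dist_eq_zero_iff.1 hv.1).symm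
      rw [this]
      exact hwp 0 (by omega)
    · obtain ⟨y, hy, hyd⟩ := hΓ.exists_mem_interval_dist_eq (x := w) (y := p 0) (k := 2 * D)
        (by omega)
      have c1 := Γ.dist_comm (u := w) (v := y)
      have c2 := Γ.dist_comm (u := w) (v := p 0)
      have c3 := Γ.dist_comm (u := y) (v := p 0)
      have t1 := hΓ.dist_triangle (u := p 0) (v := y) (w := p n)
      have t2 := hΓ.dist_triangle (u := y) (v := w) (w := p n)
      rw [mem_interval] at hy hw
      obtain ⟨i, hi, h⟩ := hmax y (by rw [mem_interval]; omega)
      refine ⟨y, by rw [mem_interval]; omega, i, hi, h, by omega, fun v hv => ?_⟩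
      have t3 := hΓ.dist_triangle (u := w) (v := v) (w := y)
      have c4 := Γ.dist_comm (u := v) (v := y)
      rw [mem_interval] at hv
      omega
  obtain ⟨z, hzw, j, hj, hzj, hz, hwz⟩ : ∃ z, w ∈ Γ.interval y z ∧ ∃ j ≤ n,
      Γ.dist z (p j) ≤ D ∧ Γ.dist w z ≤ 2 * D ∧
        (∀ v ∈ Γ.interval z (p j), D ≤ Γ.dist w v) := by
    by_cases hc : Γ.dist w (p n) ≤ 2 * D
    · refine ⟨p n, hyw, n, le_rfl, by simp, hc, fun v hv => ?_⟩
      have : v = p n := by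
        rw [mem_interval, dist_self, Nat.add_eq_zero_iff] at hv
        exact (hΓ.dist_eq_zero_iff.1 hv.1).symm
      rw [this]
      exact hwp n le_rfl
    · obtain ⟨z, hz, hzd⟩ := hΓ.exists_mem_interval_dist_eq (x := w) (y := p n) (k := 2 * D)
        (by omega)
      have c1 := Γ.dist_comm (u := w) (v := z)
      have t1 := hΓ.dist_triangle (u := p 0) (v := z) (w := p n)
      have t2 := hΓ.dist_triangle (u := p 0) (v := w) (w := z)
      have t4 := hΓ.dist_triangle (u := y) (v := z) (w := p n)
      have t5 := hΓ.dist_triangle (u := y) (v := w) (w := z)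
      rw [mem_interval] at hz hw hyw
      obtain ⟨i, hi, h⟩ := hmax z (by rw [mem_interval]; omega)
      refine ⟨z, by rw [mem_interval]; omega, i, hi, h, by omega, fun v hv => ?_⟩
      have t3 := hΓ.dist_triangle (u := w) (v := v) (w := z)
      have c4 := Γ.dist_comm (u := v) (v := z)
      rw [mem_interval] at hv
      omega
  have cy := Γ.dist_comm (u := w) (v := y)
  have cz := Γ.dist_comm (u := w) (v := z)
  have cpi := Γ.dist_comm (u := y) (v := p i)
  have cpj := Γ.dist_comm (u := z) (v := p j)
  have hpij : Γ.dist (p i) (p j) ≤ 6 * D := by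
    have t1 := hΓ.dist_triangle (u := p i) (v := y) (w := p j)
    have t2 := hΓ.dist_triangle (u := y) (v := w) (w := p j)
    have t3 := hΓ.dist_triangle (u := w) (v := z) (w := p j)
    omega
  -- The quadrilateral `y`, `p i`, `p j`, `z` is cut into two triangles. If `w` is near an outer
  -- side then `D ≤ 2 * δ`; otherwise it is near the interval from `p i` to `p j`.
  obtain ⟨v, hv, hd⟩ := h _ _ (p i) w hzw
  rcases hv with hv | hv
  · have := hwy v hv
    omega
  obtain ⟨v', hv', hd'⟩ := h _ _ (p j) v hv
  have t1 := hΓ.dist_triangle (u := w) (v := v) (w := v')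
  rcases hv' with hv' | hv'
  · obtain ⟨k, hk, hdk⟩ : ∃ k ≤ n, Γ.dist v' (p k) ≤ δ * N + K := by
      have hN' : ∀ m, m ≤ K * (6 * D) + K → m ≤ 2 ^ N := fun m hm => by
        refine hm.trans (le_trans (le_of_eq ?_) hN)
        ring
      have hmul := Nat.mul_le_mul_left K hpij
      rcases le_total i j with hij | hij
      · obtain ⟨k, _, h2, h3⟩ := h.exists_dist_le_of_chain hΓ (K := K) (p := p) N i j hij
          (hN' _ ((hp.lower i j hij hj).trans (by omega)))
          (fun k _ hk => hp.step k (by omega)) v' hv'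
        exact ⟨k, by omega, h3⟩
      · rw [interval_comm] at hv'
        rw [Γ.dist_comm] at hmul
        obtain ⟨k, _, h2, h3⟩ := h.exists_dist_le_of_chain hΓ (K := K) (p := p) N j i hij
          (hN' _ ((hp.lower j i hij hi).trans (by omega)))
          (fun k _ hk => hp.step k (by omega)) v' hv'
        exact ⟨k, by omega, h3⟩
    have t2 := hΓ.dist_triangle (u := w) (v := v') (w := p k)
    have := hwp k hk
    omega
  · rw [interval_comm] at hv'
    have := hwz v' hv'
    omega

/-- Along a geodesic between the ends, take the last vertex near a chain point of index at most `i`.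
It is also near one of index at least `i`. Those two chain points are then close, so their indices
are too, and `p i` is trapped between them. -/
theorem HasSlimIntervals.exists_dist_interval_le {δ : ℕ} (hΓ : Γ.Connected)
    (h : Γ.HasSlimIntervals δ) (K : ℕ) :
    ∃ D₁ : ℕ, ∀ (n : ℕ) (p : ℕ → V), Γ.IsQuasiGeodesic K n p →
      ∀ i ≤ n, ∃ w ∈ Γ.interval (p 0) (p n), Γ.dist (p i) w ≤ D₁ := by
  classical
  obtain ⟨D, hD⟩ := h.exists_dist_quasiGeodesic_le hΓ K
  refine ⟨K * (K * (2 * D + 1) + K) + D, fun n p hp i hi => ?_⟩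
  set m := Γ.dist (p 0) (p n) with hm
  obtain ⟨r, hr⟩ := hΓ.exists_walk_length_eq_dist (p 0) (p n)
  have hrI : ∀ k, r.getVert k ∈ Γ.interval (p 0) (p n) := fun k =>
    r.mem_interval_of_mem_support hΓ hr (r.getVert_mem_support k)
  let A : ℕ → Prop := fun k => ∃ j ≤ i, Γ.dist (r.getVert k) (p j) ≤ D
  have hA0 : A 0 := ⟨0, by omega, by simp⟩
  set k := Nat.findGreatest A m with hk
  have hkm : k ≤ m := Nat.findGreatest_le m
  obtain ⟨j, hj, hkj⟩ : A k := Nat.findGreatest_spec (Nat.zero_le _) hA0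
  obtain ⟨j', hj', hjn', hkj'⟩ : ∃ j', i ≤ j' ∧ j' ≤ n ∧ Γ.dist (r.getVert k) (p j') ≤ D + 1 := by
    rcases Nat.eq_or_lt_of_le hkm with hkm | hkm
    · refine ⟨n, hi, le_rfl, ?_⟩
      rw [hkm, hm, ← hr, Walk.getVert_length, dist_self]
      omega
    · have hnot : ¬ A (k + 1) := fun hA => by
        have := Nat.le_findGreatest (P := A) hkm hA
        omega
      obtain ⟨j', hj', hd⟩ := hD n p hp _ (hrI (k + 1))
      have hlt : i < j' := by
        by_contra! hle
        exact hnot ⟨j', hle, hd⟩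
      refine ⟨j', hlt.le, hj', ?_⟩
      have hadj := dist_eq_one_iff_adj.2 (r.adj_getVert_succ (i := k) (by omega))
      have := hΓ.dist_triangle (u := r.getVert k) (v := r.getVert (k + 1)) (w := p j')
      omega
  refine ⟨r.getVert k, hrI k, ?_⟩
  have t1 := hΓ.dist_triangle (u := p j) (v := r.getVert k) (w := p j')
  have t2 := hΓ.dist_triangle (u := p i) (v := p j) (w := r.getVert k)
  have c1 := Γ.dist_comm (u := p j) (v := r.getVert k)
  have c2 := Γ.dist_comm (u := p j) (v := p i)
  have h1 := hp.lower j j' (by omega) hjn'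
  have h2 := hp.dist_le hΓ j i hj hi
  have h3 : K * Γ.dist (p j) (p j') ≤ K * (2 * D + 1) := Nat.mul_le_mul_left _ (by omega)
  have h4 : K * (i - j) ≤ K * (K * (2 * D + 1) + K) := Nat.mul_le_mul_left _ (by omega)
  omega

/-! ### Pulling hyperbolicity back along quasi-isometric embeddings -/

theorem Connected.isQuasiGeodesic_map (hΓ : Γ.Connected) {f : V → W} {K : ℕ}
    (hup : ∀ x y, Γ.Adj x y → Δ.dist (f x) (f y) ≤ K)
    (hlow : ∀ x y, Γ.dist x y ≤ K * Δ.dist (f x) (f y) + K) {x y : V} (r : Γ.Walk x y)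
    (hr : r.length = Γ.dist x y) :
    Δ.IsQuasiGeodesic K r.length (fun i => f (r.getVert i)) where
  step i hi := hup _ _ (r.adj_getVert_succ hi)
  lower i j hij hj := by
    refine le_trans ?_ (hlow _ _)
    have h1 := dist_le (r.take i)
    have h2 := dist_le (r.drop j)
    rw [Walk.take_length] at h1
    rw [Walk.drop_length] at h2
    have h3 := hΓ.dist_triangle (u := x) (v := r.getVert i) (w := y)
    have h4 := hΓ.dist_triangle (u := r.getVert i) (v := r.getVert j) (w := y)
    omega

/-- Both halves of stability are used: one carries a point of a side over to `Δ`, the other brings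
the nearby point on another side back. Coarse surjectivity plays no role. -/
theorem isHyperbolicGraph_of_quasiIsometricEmbedding (hΓ : Γ.Connected)
    (hΔ : IsHyperbolicGraph Δ) {f : V → W} {K : ℕ}
    (hup : ∀ x y, Γ.Adj x y → Δ.dist (f x) (f y) ≤ K)
    (hlow : ∀ x y, Γ.dist x y ≤ K * Δ.dist (f x) (f y) + K) : IsHyperbolicGraph Γ := by
  obtain ⟨hΔ, δ, h⟩ := isHyperbolicGraph_iff.1 hΔ
  obtain ⟨D₀, hD₀⟩ := h.exists_dist_quasiGeodesic_le hΔ K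
  obtain ⟨D₁, hD₁⟩ := h.exists_dist_interval_le hΔ K
  have key₀ : ∀ x y, ∀ w ∈ Δ.interval (f x) (f y), ∃ u ∈ Γ.interval x y,
      Δ.dist w (f u) ≤ D₀ := by
    intro x y w hw
    obtain ⟨r, hr⟩ := hΓ.exists_walk_length_eq_dist x y
    obtain ⟨i, _, h⟩ := hD₀ _ _ (hΓ.isQuasiGeodesic_map hup hlow r hr) w (by simpa using hw)
    exact ⟨_, r.mem_interval_of_mem_support hΓ hr (r.getVert_mem_support i), h⟩
  have key₁ : ∀ x y, ∀ u ∈ Γ.interval x y, ∃ w ∈ Δ.interval (f x) (f y),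
      Δ.dist (f u) w ≤ D₁ := by
    intro x y u hu
    obtain ⟨r, hr, hur⟩ := hΓ.exists_geodesic_through hu
    obtain ⟨i, rfl, hi⟩ := Walk.mem_support_iff_exists_getVert.1 hur
    simpa using hD₁ _ _ (hΓ.isQuasiGeodesic_map hup hlow r hr) i hi
  refine isHyperbolicGraph_iff.2 ⟨hΓ, K * (D₁ + δ + D₀) + K, fun x y z u hu => ?_⟩
  obtain ⟨w, hw, h1⟩ := key₁ x y u hu
  obtain ⟨w', hw', h2⟩ := h _ _ (f z) w hw
  obtain ⟨v, hv, h3⟩ : ∃ v, (v ∈ Γ.interval x z ∨ v ∈ Γ.interval z y) ∧ Δ.dist w' (f v) ≤ D₀ := by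
    rcases hw' with hw' | hw'
    · obtain ⟨v, hv, h⟩ := key₀ _ _ w' hw'
      exact ⟨v, Or.inl hv, h⟩
    · obtain ⟨v, hv, h⟩ := key₀ _ _ w' hw'
      exact ⟨v, Or.inr hv, h⟩
  refine ⟨v, hv, (hlow u v).trans (Nat.add_le_add_right (Nat.mul_le_mul_left _ ?_) _)⟩
  have t1 := hΔ.dist_triangle (u := f u) (v := w) (w := f v)
  have t2 := hΔ.dist_triangle (u := w) (v := w') (w := f v)
  omega

end SimpleGraph

/-! ### Coarse equivalence of vertex sets -/

namespace SimpleGraph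

variable {V : Type*} {Γ : SimpleGraph V}

/-- The Hausdorff distance of `A` and `B` is at most `m`. -/
def HausdorffClose (Γ : SimpleGraph V) (m : ℕ) (A B : Set V) : Prop :=
  (∀ a ∈ A, ∃ b ∈ B, Γ.dist a b ≤ m) ∧ ∀ b ∈ B, ∃ a ∈ A, Γ.dist b a ≤ m

theorem HausdorffClose.symm {m : ℕ} {A B : Set V} (h : Γ.HausdorffClose m A B) :
    Γ.HausdorffClose m B A := And.symm h

theorem HausdorffClose.mono {m n : ℕ} {A B : Set V} (h : Γ.HausdorffClose m A B) (hmn : m ≤ n) :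
    Γ.HausdorffClose n A B :=
  ⟨fun a ha => (h.1 a ha).imp fun _ hb => ⟨hb.1, hb.2.trans hmn⟩,
    fun b hb => (h.2 b hb).imp fun _ ha => ⟨ha.1, ha.2.trans hmn⟩⟩

theorem HausdorffClose.trans (hΓ : Γ.Connected) {m n : ℕ} {A B C : Set V}
    (h : Γ.HausdorffClose m A B) (h' : Γ.HausdorffClose n B C) :
    Γ.HausdorffClose (m + n) A C := by
  constructor
  · intro a ha
    obtain ⟨b, hb, h1⟩ := h.1 a ha
    obtain ⟨c, hc, h2⟩ := h'.1 b hb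
    exact ⟨c, hc, hΓ.dist_triangle.trans (add_le_add h1 h2)⟩
  · intro c hc
    obtain ⟨b, hb, h1⟩ := h'.2 c hc
    obtain ⟨a, ha, h2⟩ := h.2 b hb
    exact ⟨a, ha, hΓ.dist_triangle.trans ((add_le_add h1 h2).trans_eq (add_comm n m))⟩

/-- `A` and `B` have finite Hausdorff distance. -/
def CoarseEq (Γ : SimpleGraph V) (A B : Set V) : Prop := ∃ m, Γ.HausdorffClose m A B

theorem CoarseEq.refl (A : Set V) : Γ.CoarseEq A A :=
  ⟨0, fun a ha => ⟨a, ha, by simp⟩, fun a ha => ⟨a, ha, by simp⟩⟩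

theorem CoarseEq.symm {A B : Set V} (h : Γ.CoarseEq A B) : Γ.CoarseEq B A :=
  h.imp fun _ h => h.symm

theorem CoarseEq.trans (hΓ : Γ.Connected) {A B C : Set V} (h : Γ.CoarseEq A B)
    (h' : Γ.CoarseEq B C) : Γ.CoarseEq A C := by
  obtain ⟨m, h⟩ := h
  obtain ⟨n, h'⟩ := h'
  exact ⟨m + n, h.trans hΓ h'⟩

theorem hausdorffClose_of_graphHausdorffDist_lt (hΓ : Γ.Connected) {A B : Set V} {M : ℕ}
    (h : graphHausdorffDist Γ A B < M) : Γ.HausdorffClose M A B := by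
  have aux : ∀ {A B : Set V}, (⨆ a ∈ A, ⨅ b ∈ B, Γ.edist a b) < M →
      ∀ a ∈ A, ∃ b ∈ B, Γ.dist a b ≤ M := by
    intro A B h a ha
    have h1 := lt_of_le_of_lt (le_iSup₂ (f := fun a (_ : a ∈ A) => ⨅ b ∈ B, Γ.edist a b) a ha) h
    simp only [iInf_lt_iff] at h1
    obtain ⟨b, hb, h1⟩ := h1
    refine ⟨b, hb, ?_⟩
    rw [← (hΓ a b).coe_dist_eq_edist, Nat.cast_lt] at h1
    exact h1.le
  have h1 := max_lt_iff.1 h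
  refine ⟨aux h1.1, fun b hb => ?_⟩
  refine aux (A := B) (B := A) ?_ b hb
  have h2 := h1.2
  simp only [Γ.edist_comm] at h2 ⊢
  exact h2

end SimpleGraph

theorem Set.Finite.exists_nat_bound {α : Type*} {s : Set α} (hs : s.Finite) {p : α → ℕ → Prop}
    (hp : ∀ a m n, m ≤ n → p a m → p a n) (h : ∀ a ∈ s, ∃ m, p a m) : ∃ m, ∀ a ∈ s, p a m := by
  induction s, hs using Set.Finite.induction_on with
  | empty => exact ⟨0, by simp⟩
  | @insert a s _ _ ih =>
    obtain ⟨m, hm⟩ := ih fun b hb => h b (Set.mem_insert_of_mem a hb)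
    obtain ⟨n, hn⟩ := h a (Set.mem_insert a s)
    refine ⟨max m n, ?_⟩
    rintro b (rfl | hb)
    · exact hp _ _ _ (le_max_right _ _) hn
    · exact hp _ _ _ (le_max_left _ _) (hm b hb)

/-! ### Word metrics -/

namespace SimpleGraph

variable {G : Type*} [Group G] {S : Set G}

theorem mulCayley_connected (hS : Subgroup.closure S = ⊤) : (mulCayley S).Connected := by
  have key : ∀ g : G, g ∈ Subgroup.closure S → ∀ x, (mulCayley S).Reachable x (x * g) := by
    intro g hg
    induction hg using Subgroup.closure_induction with
    | mem s hs =>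
      intro x
      by_cases h : x = x * s
      · rw [← h]
      · exact Adj.reachable ((mulCayley_adj _ _ _).2 ⟨h, Or.inl (by simpa using hs)⟩)
    | one => intro x; simp
    | mul a b _ _ ha hb =>
      intro x
      rw [← mul_assoc]
      exact (ha x).trans (hb _)
    | inv a _ ha =>
      intro x
      simpa using (ha (x * a⁻¹)).symm
  refine (connected_iff _).2 ⟨fun x y => ?_, ⟨1⟩⟩
  simpa using key (x⁻¹ * y) (by rw [hS]; trivial) x

theorem dist_mul_left_le {Γ : SimpleGraph G} (hΓ : Γ.Connected)
    (h : ∀ a x y, Γ.Adj x y → Γ.Adj (a * x) (a * y)) (a x y : G) :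
    Γ.dist (a * x) (a * y) ≤ Γ.dist x y := by
  simpa using hΓ.dist_map_le hΓ (f := (a * ·)) (K := 1)
    (fun x y hxy => (dist_eq_one_iff_adj.2 (h a x y hxy)).le) x y

theorem mulCayley_dist_mul_left (hS : Subgroup.closure S = ⊤) (a x y : G) :
    (mulCayley S).dist (a * x) (a * y) = (mulCayley S).dist x y := by
  have h := dist_mul_left_le (mulCayley_connected hS)
    (fun a x y h => mulCayley_adj_mul_iff_right.2 h)
  refine le_antisymm (h a x y) ?_
  simpa using h a⁻¹ (a * x) (a * y)

theorem mulCayley_finite_ball (hS : Subgroup.closure S = ⊤) (hfin : S.Finite) (x : G) (n : ℕ) :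
    {y | (mulCayley S).dist x y ≤ n}.Finite := by
  have hc := mulCayley_connected hS
  induction n with
  | zero =>
    refine (Set.finite_singleton x).subset fun y hy => ?_
    exact (hc.dist_eq_zero_iff.1 (Nat.le_zero.1 hy)).symm
  | succ n ih =>
    refine (ih.union (ih.mul (hfin.union hfin.inv))).subset fun y hy => ?_
    rcases Nat.lt_or_ge ((mulCayley S).dist x y) (n + 1) with hlt | hge
    · exact Or.inl (Nat.lt_succ_iff.1 hlt)
    · right
      have hd : (mulCayley S).dist x y = n + 1 := le_antisymm hy hge
      obtain ⟨z, hz, hzn⟩ := hc.exists_mem_interval_dist_eq (x := x) (y := y) (k := n) (by omega)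
      rw [mem_interval] at hz
      have hadj := dist_eq_one_iff_adj.1 (show (mulCayley S).dist z y = 1 by omega)
      refine Set.mem_mul.2 ⟨z, hzn.le, z⁻¹ * y, ?_, by simp⟩
      rcases ((mulCayley_adj _ _ _).1 hadj).2 with h | h
      · exact Or.inl h
      · right
        simpa using h

theorem HausdorffClose.smul (hS : Subgroup.closure S = ⊤) {m : ℕ} {A B : Set G}
    (h : (mulCayley S).HausdorffClose m A B) (g : G) :
    (mulCayley S).HausdorffClose m (g • A) (g • B) := by
  constructor
  · rintro _ ⟨a, ha, rfl⟩
    obtain ⟨b, hb, h⟩ := h.1 a ha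
    exact ⟨g • b, ⟨b, hb, rfl⟩, by simpa [mulCayley_dist_mul_left hS] using h⟩
  · rintro _ ⟨b, hb, rfl⟩
    obtain ⟨a, ha, h⟩ := h.2 b hb
    exact ⟨g • a, ⟨a, ha, rfl⟩, by simpa [mulCayley_dist_mul_left hS] using h⟩

theorem CoarseEq.smul (hS : Subgroup.closure S = ⊤) {A B : Set G}
    (h : (mulCayley S).CoarseEq A B) (g : G) : (mulCayley S).CoarseEq (g • A) (g • B) :=
  h.imp fun _ h => h.smul hS g

theorem coarseEq_smul_iff (hS : Subgroup.closure S = ⊤) {A B : Set G} (g : G) :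
    (mulCayley S).CoarseEq (g • A) (g • B) ↔ (mulCayley S).CoarseEq A B :=
  ⟨fun h => by simpa using h.smul hS g⁻¹, fun h => h.smul hS g⟩

/-! ### Commensurators as coarse stabilizers -/

/-- Cosets of `K ∩ K'` in `K` are separated by the elements `k * k'` lying in a fixed ball about
`1`, and balls are finite. -/
theorem relIndex_ne_zero_iff (hS : Subgroup.closure S = ⊤) (hfin : S.Finite) (K K' : Subgroup G) :
    K'.relIndex K ≠ 0 ↔ ∃ m, ∀ k ∈ K, ∃ k' ∈ K', (mulCayley S).dist k k' ≤ m := by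
  constructor
  · intro h
    have : (K'.subgroupOf K).FiniteIndex := ⟨h⟩
    have : Finite (K ⧸ K'.subgroupOf K) := Subgroup.finite_quotient_of_finiteIndex
    obtain ⟨m, hm⟩ := (Set.finite_univ (α := K ⧸ K'.subgroupOf K)).exists_nat_bound
      (p := fun c m => (mulCayley S).dist 1 ((c.out : G)⁻¹) ≤ m)
      (fun _ _ _ hmn h => h.trans hmn) (fun c _ => ⟨_, le_rfl⟩)
    refine ⟨m, fun k hk => ?_⟩
    -- The coset of `k⁻¹` is used because a left-invariant metric controls multiplication by the
    -- representative on the right.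
    let c : K ⧸ K'.subgroupOf K := QuotientGroup.mk ⟨k⁻¹, K.inv_mem hk⟩
    have hc : (c.out)⁻¹ * (⟨k⁻¹, K.inv_mem hk⟩ : K) ∈ K'.subgroupOf K :=
      QuotientGroup.eq.1 (QuotientGroup.out_eq' c)
    rw [Subgroup.mem_subgroupOf] at hc
    refine ⟨k * (c.out : G), by simpa using K'.inv_mem hc, ?_⟩
    have := hm c trivial
    rw [dist_comm, ← mulCayley_dist_mul_left hS (k * (c.out : G))] at this
    simpa using this
  · rintro ⟨m, h⟩
    have hball := mulCayley_finite_ball hS hfin 1 m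
    have hex : ∀ k : K, ∃ s : {y | (mulCayley S).dist 1 y ≤ m}, (k : G)⁻¹ * (s : G) ∈ K' := by
      intro k
      obtain ⟨k', hk', hd⟩ := h (k⁻¹ : G) (K.inv_mem k.2)
      rw [← mulCayley_dist_mul_left hS (k : G), mul_inv_cancel] at hd
      exact ⟨⟨k * k', hd⟩, by simpa using hk'⟩
    have : Finite {y | (mulCayley S).dist 1 y ≤ m} := hball
    have hfq : Finite (K ⧸ K'.subgroupOf K) := by
      choose s hs using hex
      refine Finite.of_injective (fun c : K ⧸ K'.subgroupOf K => s c.out) fun c c' hcc => ?_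
      rw [← QuotientGroup.out_eq' c, ← QuotientGroup.out_eq' c']
      refine QuotientGroup.eq.2 ?_
      have hs' := hs c'.out
      rw [← show s c.out = s c'.out from hcc] at hs'
      rw [Subgroup.mem_subgroupOf]
      simpa [mul_assoc] using K'.mul_mem (hs c.out) (K'.inv_mem hs')
    exact Subgroup.index_ne_zero_of_finite (H := K'.subgroupOf K)

theorem commensurable_iff_coarseEq (hS : Subgroup.closure S = ⊤) (hfin : S.Finite)
    (K K' : Subgroup G) :
    Subgroup.Commensurable K K' ↔ (mulCayley S).CoarseEq (K : Set G) (K' : Set G) := by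
  rw [Subgroup.Commensurable, relIndex_ne_zero_iff hS hfin, relIndex_ne_zero_iff hS hfin]
  constructor
  · rintro ⟨⟨m, hm⟩, ⟨n, hn⟩⟩
    exact ⟨max m n, fun a ha => (hn a ha).imp fun _ h => ⟨h.1, h.2.trans (le_max_right _ _)⟩,
      fun a ha => (hm a ha).imp fun _ h => ⟨h.1, h.2.trans (le_max_left _ _)⟩⟩
  · rintro ⟨m, h1, h2⟩
    exact ⟨⟨m, h2⟩, ⟨m, h1⟩⟩

theorem coarseEq_conj_smul (hS : Subgroup.closure S = ⊤) (g : G) (P : Subgroup G) :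
    (mulCayley S).CoarseEq ((MulAut.conj g • P : Subgroup G) : Set G) (g • (P : Set G)) := by
  refine ⟨(mulCayley S).dist 1 g, ?_, ?_⟩
  · intro a ha
    obtain ⟨p, hp, rfl⟩ := (Subgroup.mem_smul_pointwise_iff_exists _ _ _).1 ha
    refine ⟨g • p, ⟨p, hp, rfl⟩, le_of_eq ?_⟩
    rw [← mulCayley_dist_mul_left hS (g * p * g⁻¹) 1 g]
    simp [MulAut.smul_def]
  · rintro _ ⟨p, hp, rfl⟩
    refine ⟨_, Subgroup.smul_mem_pointwise_smul p (MulAut.conj g) P hp, le_of_eq ?_⟩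
    rw [dist_comm, ← mulCayley_dist_mul_left hS (g * p * g⁻¹) 1 g]
    simp [MulAut.smul_def]

/-- The subgroup `gPg⁻¹` is at finite Hausdorff distance from `gP`, so the commensurator is the
stabilizer of the coarse class of `gP`. -/
theorem mem_commensurator_conj_iff (hS : Subgroup.closure S = ⊤) (hfin : S.Finite) {g x : G}
    {P : Subgroup G} :
    x ∈ Subgroup.Commensurable.commensurator (MulAut.conj g • P) ↔
      (mulCayley S).CoarseEq (x • g • (P : Set G)) (g • (P : Set G)) := by
  have hc := mulCayley_connected hS
  have h1 := coarseEq_conj_smul hS g P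
  have h2 := (coarseEq_conj_smul hS x (MulAut.conj g • P)).trans hc (h1.smul hS x)
  have h3 : ConjAct.toConjAct x • (MulAut.conj g • P) = MulAut.conj x • (MulAut.conj g • P) := rfl
  rw [Subgroup.Commensurable.commensurator_mem_iff, h3, commensurable_iff_coarseEq hS hfin]
  exact ⟨fun h => h2.symm.trans hc (h.trans hc h1), fun h => h2.trans hc (h.trans hc h1.symm)⟩

theorem conj_smul_commensurator_eq (hS : Subgroup.closure S = ⊤) (hfin : S.Finite) {c g g' : G}
    {P P' : Subgroup G}
    (h : (mulCayley S).CoarseEq (c • g • (P : Set G)) (g' • (P' : Set G))) :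
    MulAut.conj c • Subgroup.Commensurable.commensurator (MulAut.conj g • P) =
      Subgroup.Commensurable.commensurator (MulAut.conj g' • P') := by
  have hc := mulCayley_connected hS
  ext y
  rw [Subgroup.mem_pointwise_smul_iff_inv_smul_mem, mem_commensurator_conj_iff hS hfin,
    mem_commensurator_conj_iff hS hfin, ← coarseEq_smul_iff hS c]
  have e : c • ((MulAut.conj c)⁻¹ • y) • g • (P : Set G) = y • c • g • (P : Set G) := by
    simp only [← mul_smul, ← map_inv, MulAut.smul_def, MulAut.conj_apply]
    congr 1
    group
  rw [e]
  have h' := h.smul hS y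
  exact ⟨fun k => h'.symm.trans hc (k.trans hc h), fun k => h'.trans hc (k.trans hc h.symm)⟩

end SimpleGraph

/-! ### Refinements -/

section Refinement

open SimpleGraph

variable {G : Type*} [Group G] {S : Set G} {Ps Pstar : Set (Subgroup G)}

theorem IsRefinement.eq_of_conj (h : IsRefinement Ps Pstar) {R R' : Subgroup G} (hR : R ∈ Pstar)
    (hR' : R' ∈ Pstar) {c : G} (hc : MulAut.conj c • R = R') : R = R' :=
  (h.2 R (h.1 hR)).unique ⟨hR, 1, by simp⟩ ⟨hR', c, hc⟩

/-- Representatives arising from the same `P` are conjugate, hence equal, so choosing a `P` for each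
is injective. -/
theorem IsRefinement.finite (hS : Subgroup.closure S = ⊤) (hfin : S.Finite) (hPs : Ps.Finite)
    (h : IsRefinement Ps Pstar) : Pstar.Finite := by
  have h1 : ∀ R ∈ Pstar, R ∈ commensuratorCollection Ps := fun R hR => h.1 hR
  choose! P hP g hg using h1
  refine Set.Finite.of_injOn (f := P) (t := Ps) (fun R hR => hP R hR) (fun R hR R' hR' e => ?_) hPs
  refine h.eq_of_conj hR hR' (c := g R' * (g R)⁻¹) ?_
  have key := conj_smul_commensurator_eq hS hfin (c := g R' * (g R)⁻¹) (g := g R) (g' := g R')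
    (P := P R) (P' := P R') (by
      rw [e, smul_smul, inv_mul_cancel_right]
      exact CoarseEq.refl _)
  rwa [← hg R hR, ← hg R' hR'] at key

/-- For `x` in the commensurator, `xgP` is coarsely `gP`; the uniform `m` bounds how far `x * g` is
from `gP` independently of `x`. Conversely `gPg⁻¹` fixes `gP`. -/
theorem coarseEq_commensurator (hS : Subgroup.closure S = ⊤) (hfin : S.Finite)
    {m : ℕ} (hm : ∀ A ∈ cosetCollection Ps, ∀ A' ∈ cosetCollection Ps,
      (mulCayley S).CoarseEq A A' → (mulCayley S).HausdorffClose m A A')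
    {P : Subgroup G} (hP : P ∈ Ps) (g : G) :
    (mulCayley S).CoarseEq
      (Subgroup.Commensurable.commensurator (MulAut.conj g • P) : Set G) (g • (P : Set G)) := by
  have hc := mulCayley_connected hS
  refine ⟨(mulCayley S).dist 1 g + m, ?_, ?_⟩
  · intro x hx
    have hx' := (mem_commensurator_conj_iff hS hfin).1 hx
    have hx'' := hm _ ⟨x * g, P, hP, smul_smul _ _ _⟩ _ ⟨g, P, hP, rfl⟩ hx'
    obtain ⟨b, hb, hd⟩ := hx''.1 (x • g • 1) ⟨_, ⟨1, P.one_mem, rfl⟩, rfl⟩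
    refine ⟨b, hb, (hc.dist_triangle (v := x * g)).trans (add_le_add ?_ (by simpa using hd))⟩
    rw [← mulCayley_dist_mul_left hS x 1 g, mul_one]
  · rintro _ ⟨p, hp, rfl⟩
    refine ⟨g * p * g⁻¹, ?_, ?_⟩
    · refine (mem_commensurator_conj_iff hS hfin).2 ?_
      have : (g * p * g⁻¹) • g • (P : Set G) = g • (P : Set G) := by
        rw [smul_smul, inv_mul_cancel_right, mul_smul, smul_coe_set hp]
      rw [this]
      exact CoarseEq.refl _
    · refine le_trans (le_of_eq ?_) (Nat.le_add_right _ _)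
      rw [dist_comm, ← mulCayley_dist_mul_left hS (g * p * g⁻¹) 1 g]
      simp

/-- The element `x'⁻¹ * x` carries the coarse class of `R` to that of `R'`, so it conjugates one
stabilizer to the other and `R = R'`. It then stabilizes the class of `R`, so it lies in `R`. -/
theorem IsRefinement.eq_of_coarseEq (hS : Subgroup.closure S = ⊤) (hfin : S.Finite)
    {m : ℕ} (hm : ∀ A ∈ cosetCollection Ps, ∀ A' ∈ cosetCollection Ps,
      (mulCayley S).CoarseEq A A' → (mulCayley S).HausdorffClose m A A')
    (h : IsRefinement Ps Pstar) {A A' : Set G} (hA : A ∈ cosetCollection Pstar)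
    (hA' : A' ∈ cosetCollection Pstar) (hAA' : (mulCayley S).CoarseEq A A') : A = A' := by
  have hc := mulCayley_connected hS
  obtain ⟨x, R, hR, rfl⟩ := hA
  obtain ⟨x', R', hR', rfl⟩ := hA'
  obtain ⟨P, hP, g, hg⟩ := h.1 hR
  obtain ⟨P', hP', g', hg'⟩ := h.1 hR'
  have e : (mulCayley S).CoarseEq (R : Set G) (g • (P : Set G)) := by
    rw [hg]
    exact coarseEq_commensurator hS hfin hm hP g
  have e' : (mulCayley S).CoarseEq (R' : Set G) (g' • (P' : Set G)) := by
    rw [hg']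
    exact coarseEq_commensurator hS hfin hm hP' g'
  have e'' : (mulCayley S).CoarseEq ((x'⁻¹ * x) • (R : Set G)) (R' : Set G) := by
    simpa [mul_smul] using hAA'.smul hS x'⁻¹
  have hRR' : R = R' := by
    refine h.eq_of_conj hR hR' (c := x'⁻¹ * x) ?_
    rw [hg, hg']
    exact conj_smul_commensurator_eq hS hfin ((e.smul hS _).symm.trans hc (e''.trans hc e'))
  subst hRR'
  have hmem : x'⁻¹ * x ∈ R := by
    rw [hg]
    exact (mem_commensurator_conj_iff hS hfin).2 ((e.smul hS _).symm.trans hc (e''.trans hc e))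
  calc x • (R : Set G) = x' • (x'⁻¹ * x) • (R : Set G) := by rw [smul_smul, mul_inv_cancel_left]
    _ = x' • (R : Set G) := by rw [smul_coe_set hmem]

theorem IsRefinement.exists_hausdorffClose (hS : Subgroup.closure S = ⊤) (hfin : S.Finite)
    (hPs : Ps.Finite) {m : ℕ} (hm : ∀ A ∈ cosetCollection Ps, ∀ A' ∈ cosetCollection Ps,
      (mulCayley S).CoarseEq A A' → (mulCayley S).HausdorffClose m A A')
    (h : IsRefinement Ps Pstar) :
    ∃ n, (∀ A ∈ cosetCollection Pstar, ∃ A' ∈ cosetCollection Ps,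
        (mulCayley S).HausdorffClose n A A') ∧
      ∀ A ∈ cosetCollection Ps, ∃ A' ∈ cosetCollection Pstar,
        (mulCayley S).HausdorffClose n A A' := by
  have aux : ∀ {Ps Ps' : Set (Subgroup G)}, Ps.Finite →
      (∀ P ∈ Ps, ∃ P' ∈ Ps', ∃ g : G, (mulCayley S).CoarseEq (P : Set G) (g • (P' : Set G))) →
      ∃ n, ∀ A ∈ cosetCollection Ps, ∃ A' ∈ cosetCollection Ps',
        (mulCayley S).HausdorffClose n A A' := by
    intro Ps Ps' hPs h
    obtain ⟨n, hn⟩ := hPs.exists_nat_bound (p := fun P n => ∃ P' ∈ Ps', ∃ g : G,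
      (mulCayley S).HausdorffClose n (P : Set G) (g • (P' : Set G)))
      (fun P k l hkl ⟨P', hP', g, h⟩ => ⟨P', hP', g, h.mono hkl⟩)
      (fun P hP => by
        obtain ⟨P', hP', g, n, h⟩ := h P hP
        exact ⟨n, P', hP', g, h⟩)
    refine ⟨n, ?_⟩
    rintro _ ⟨x, P, hP, rfl⟩
    obtain ⟨P', hP', g, h⟩ := hn P hP
    exact ⟨_, ⟨x * g, P', hP', rfl⟩, by rw [mul_smul]; exact h.smul hS x⟩
  obtain ⟨n, hn⟩ := aux (h.finite hS hfin hPs) (Ps' := Ps) (fun R hR => by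
    obtain ⟨P, hP, g, rfl⟩ := h.1 hR
    exact ⟨P, hP, g, coarseEq_commensurator hS hfin hm hP g⟩)
  obtain ⟨n', hn'⟩ := aux hPs (Ps' := Pstar) (fun P hP => by
    obtain ⟨R, ⟨hR, g, hg⟩, -⟩ := h.2 _ ⟨P, hP, 1, rfl⟩
    refine ⟨R, hR, g⁻¹, ?_⟩
    have h1 := coarseEq_commensurator hS hfin hm hP 1
    have h2 := coarseEq_conj_smul hS g
      (Subgroup.Commensurable.commensurator (MulAut.conj (1 : G) • P))
    rw [hg] at h2
    rw [one_smul] at h1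
    refine h1.symm.trans (mulCayley_connected hS) ?_
    simpa using h2.symm.smul hS g⁻¹)
  exact ⟨max n n', fun A hA => (hn A hA).imp fun _ h => ⟨h.1, h.2.mono (le_max_left _ _)⟩,
    fun A hA => (hn' A hA).imp fun _ h => ⟨h.1, h.2.mono (le_max_right _ _)⟩⟩

end Refinement

/-! ### Relative Cayley graphs of cosets -/

section RelativeCayleyGraph

open SimpleGraph

variable {G : Type*} [Group G]

/-- The Cayley graph of `G` with respect to `X` and all `Q ∈ Ps`, without the edges of the coset `B`
labelled by letters of the corresponding subgroup. -/
def cosetRelativeCayleyGraph (Ps : Set (Subgroup G)) (X : Set G) (B : Set G) : SimpleGraph G :=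
  SimpleGraph.fromRel fun g h => g⁻¹ * h ∈ X ∨ ∃ Q ∈ Ps, g⁻¹ * h ∈ Q ∧ g • (Q : Set G) ≠ B

variable {Ps : Set (Subgroup G)} {X : Set G}

theorem mem_smul_subgroup_iff {g h : G} {Q : Subgroup G} : h ∈ g • (Q : Set G) ↔ g⁻¹ * h ∈ Q := by
  rw [Set.mem_smul_set_iff_inv_smul_mem]
  rfl

theorem smul_subgroup_eq_of_mem {g h : G} {Q : Subgroup G} (hh : h ∈ g • (Q : Set G)) :
    h • (Q : Set G) = g • (Q : Set G) := by
  rw [mem_smul_subgroup_iff] at hh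
  calc h • (Q : Set G) = g • (g⁻¹ * h) • (Q : Set G) := by rw [smul_smul, mul_inv_cancel_left]
    _ = g • (Q : Set G) := by rw [smul_coe_set hh]

/-- If `gQ = P` as sets then `g ∈ P` and `Q = P`. The coset form is the one compatible with left
translation. -/
theorem relativeCayleyGraph_eq (Ps : Set (Subgroup G)) (X : Set G) (P : Subgroup G) :
    relativeCayleyGraph Ps X P = cosetRelativeCayleyGraph Ps X (P : Set G) := by
  unfold relativeCayleyGraph cosetRelativeCayleyGraph
  congr 1
  ext g h
  refine or_congr Iff.rfl (exists_congr fun Q => and_congr Iff.rfl (and_congr_right fun hgh => ?_))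
  refine not_congr ⟨?_, fun e => ?_⟩
  · rintro ⟨rfl, hg, -⟩
    exact smul_coe_set hg
  · have hgP : g ∈ P := by
      rw [← SetLike.mem_coe, ← e, mem_smul_subgroup_iff]
      simp
    have hQP : Q = P := by
      rw [← SetLike.coe_set_eq, ← smul_coe_set (inv_mem hgP), ← e, inv_smul_smul]
    subst hQP
    exact ⟨rfl, hgP, (Subgroup.mul_mem_cancel_left _ (inv_mem hgP)).1 hgh⟩

theorem cosetRelativeCayleyGraph_adj_smul (B : Set G) {a g h : G}
    (hgh : (cosetRelativeCayleyGraph Ps X B).Adj g h) :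
    (cosetRelativeCayleyGraph Ps X (a • B)).Adj (a * g) (a * h) := by
  simp only [cosetRelativeCayleyGraph, fromRel_adj, mul_inv_rev, mul_assoc, inv_mul_cancel_left,
    mul_smul, ne_eq, smul_left_cancel_iff, mul_right_inj] at hgh ⊢
  exact hgh

theorem mulCayley_le_cosetRelativeCayleyGraph (B : Set G) :
    mulCayley X ≤ cosetRelativeCayleyGraph Ps X B := by
  intro g h hgh
  obtain ⟨hne, h1⟩ := (mulCayley_adj _ _ _).1 hgh
  exact (fromRel_adj _ _ _).2 ⟨hne, h1.imp Or.inl Or.inl⟩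

theorem cosetRelativeCayleyGraph_edist_le (hX : (mulCayley X).Connected) (B : Set G) {g h : G}
    {n : ℕ} (hn : (mulCayley X).dist g h ≤ n) :
    (cosetRelativeCayleyGraph Ps X B).edist g h ≤ n := by
  refine (edist_anti (mulCayley_le_cosetRelativeCayleyGraph B)).trans ?_
  rw [← (hX g h).coe_dist_eq_edist]
  exact Nat.cast_le.2 hn

theorem cosetRelativeCayleyGraph_edist_le_one {B B' : Set G} (hB' : B' ∈ cosetCollection Ps)
    (hne : B' ≠ B) {b c : G} (hb : b ∈ B') (hc : c ∈ B') :
    (cosetRelativeCayleyGraph Ps X B).edist b c ≤ 1 := by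
  rw [edist_le_one_iff_adj_or_eq, or_iff_not_imp_right]
  intro hbc
  obtain ⟨g, Q, hQ, rfl⟩ := hB'
  have e := smul_subgroup_eq_of_mem hb
  rw [← e] at hc hne
  exact (fromRel_adj _ _ _).2 ⟨hbc, Or.inl (Or.inr ⟨Q, hQ, mem_smul_subgroup_iff.1 hc, hne⟩)⟩

theorem IsHypEmbeddedWrt.finite_coset_ball (h : IsHypEmbeddedWrt Ps X) {B : Set G}
    (hB : B ∈ cosetCollection Ps) {b : G} (hb : b ∈ B) (n : ℕ) :
    {c | c ∈ B ∧ (cosetRelativeCayleyGraph Ps X B).edist b c ≤ n}.Finite := by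
  obtain ⟨g, Q, hQ, rfl⟩ := hB
  have hf := h.2.2 Q hQ _ (mem_smul_subgroup_iff.1 hb) n
  rw [relativeCayleyGraph_eq] at hf
  refine (hf.image (g * ·)).subset ?_
  rintro c ⟨hc, hbc⟩
  refine ⟨g⁻¹ * c, ⟨mem_smul_subgroup_iff.1 hc, ?_⟩, by simp⟩
  have := edist_map_le (f := (g⁻¹ * ·)) (Δ := cosetRelativeCayleyGraph Ps X (Q : Set G)) (K := 1)
    (fun x y hxy => by
      have h1 := cosetRelativeCayleyGraph_adj_smul (a := g⁻¹) _ hxy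
      rw [inv_smul_smul] at h1
      simpa using (edist_eq_one_iff_adj.2 h1).le) hbc
  simpa using this

/-- An edge path from `u` to `v` that passes through the coset `B'`. -/
theorem cosetRelativeCayleyGraph_edist_le_of_near {S : Set G} (hX : (mulCayley X).Connected)
    {k m : ℕ} (hk : ∀ x y, (mulCayley X).dist x y ≤ k * (mulCayley S).dist x y)
    {B B' : Set G} (hB' : B' ∈ cosetCollection Ps) (hne : B' ≠ B) {u v b c : G} (hb : b ∈ B')
    (hc : c ∈ B') (hub : (mulCayley S).dist u b ≤ m) (hvc : (mulCayley S).dist v c ≤ m) :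
    (cosetRelativeCayleyGraph Ps X B).edist u v ≤ (2 * (k * m) + 1 : ℕ) := by
  have h1 := cosetRelativeCayleyGraph_edist_le (Ps := Ps) hX B
    ((hk u b).trans (Nat.mul_le_mul_left k hub))
  have h2 := cosetRelativeCayleyGraph_edist_le (Ps := Ps) hX B
    ((hk v c).trans (Nat.mul_le_mul_left k hvc))
  rw [SimpleGraph.edist_comm] at h2
  have h3 := cosetRelativeCayleyGraph_edist_le_one (X := X) hB' hne hb hc
  refine (SimpleGraph.edist_triangle (v := b)).trans ((add_le_add h1
    ((SimpleGraph.edist_triangle (v := c)).trans (add_le_add h3 h2))).trans (le_of_eq ?_))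
  push_cast
  ring

/-- If `B ≠ B'`, detours through a single edge of `B'` put all of the infinite set `B` in one ball
of its relative metric. -/
theorem IsHypEmbeddedWrt.coset_eq_of_coarseEq {S : Set G} (h : IsHypEmbeddedWrt Ps X)
    (hinf : ∀ P ∈ Ps, (P : Set G).Infinite) (hX : (mulCayley X).Connected) {k : ℕ}
    (hk : ∀ x y, (mulCayley X).dist x y ≤ k * (mulCayley S).dist x y)
    {B B' : Set G} (hB : B ∈ cosetCollection Ps) (hB' : B' ∈ cosetCollection Ps)
    (hBB' : (mulCayley S).CoarseEq B B') : B = B' := by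
  by_contra hne
  obtain ⟨m, hm, -⟩ := hBB'
  have hBinf : B.Infinite := by
    obtain ⟨g, P, hP, rfl⟩ := hB
    exact Set.infinite_smul_set.2 (hinf P hP)
  obtain ⟨b, hb⟩ := hBinf.nonempty
  refine hBinf ((h.finite_coset_ball hB hb (2 * (k * m) + 1)).subset fun c hc => ⟨hc, ?_⟩)
  obtain ⟨b', hb', h1⟩ := hm b hb
  obtain ⟨c', hc', h2⟩ := hm c hc
  exact cosetRelativeCayleyGraph_edist_le_of_near hX hk hB' (Ne.symm hne) hb' hc' h1 h2

theorem dist_le_one_of_mem_coset {B : Set G} (hB : B ∈ cosetCollection Ps) {b c : G}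
    (hb : b ∈ B) (hc : c ∈ B) :
    (mulCayley (X ∪ ⋃ P ∈ Ps, (P : Set G))).dist b c ≤ 1 := by
  by_cases hbc : b = c
  · subst hbc
    simp
  · obtain ⟨g, Q, hQ, rfl⟩ := hB
    rw [← smul_subgroup_eq_of_mem hb, mem_smul_subgroup_iff] at hc
    refine (dist_eq_one_iff_adj.2 ((mulCayley_adj _ _ _).2 ⟨hbc, Or.inl (Or.inr ?_)⟩)).le
    exact Set.mem_biUnion hQ hc

end RelativeCayleyGraph

/-! ### Transfer of hyperbolic embeddings -/

section Transfer

open SimpleGraph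

variable {G H : Type*} [Group G] [Group H]

/-- The transfer, freed of commensurators and of the choice of `X`. Injectivity `hinj` on cosets is
needed only for local finiteness. -/
theorem isHypEmbeddedWrt_of_coarse_correspondence {S₀ X : Set G} {T₀ T : Set H}
    {Ps : Set (Subgroup G)} {Qs : Set (Subgroup H)} (hS₀fin : S₀.Finite)
    (hS₀ : Subgroup.closure S₀ = ⊤) (hT₀fin : T₀.Finite) (hT₀ : Subgroup.closure T₀ = ⊤)
    (hT : Subgroup.closure T = ⊤) (hS₀X : S₀ ⊆ X) {q : G → H} {q' : H → G} {k : ℕ}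
    (hXq : ∀ u v, u⁻¹ * v ∈ X → (mulCayley T).dist (q u) (q v) ≤ k)
    (hXq' : ∀ h h', h⁻¹ * h' ∈ T → (q' h)⁻¹ * q' h' ∈ X)
    (hk : ∀ x y, (mulCayley T).dist x y ≤ k * (mulCayley T₀).dist x y)
    (hlow : ∀ x y, (mulCayley S₀).dist x y ≤ k * (mulCayley T₀).dist (q x) (q y) + k)
    (hqq' : ∀ h, (mulCayley T₀).dist (q (q' h)) h ≤ k)
    (hPQ : ∀ A ∈ cosetCollection Ps, ∃ B ∈ cosetCollection Qs,
      (mulCayley T₀).HausdorffClose k (q '' A) B)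
    (hQP : ∀ B ∈ cosetCollection Qs, ∃ A ∈ cosetCollection Ps,
      (mulCayley T₀).HausdorffClose k (q '' A) B)
    (hinj : ∀ A ∈ cosetCollection Ps, ∀ A' ∈ cosetCollection Ps, ∀ B,
      (mulCayley T₀).HausdorffClose k (q '' A) B → (mulCayley T₀).HausdorffClose k (q '' A') B →
      A = A')
    (hemb : IsHypEmbeddedWrt Qs T) : IsHypEmbeddedWrt Ps X := by
  have hgen : Subgroup.closure (X ∪ ⋃ P ∈ Ps, (P : Set G)) = ⊤ := by
    rw [eq_top_iff, ← hS₀]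
    exact Subgroup.closure_mono (hS₀X.trans Set.subset_union_left)
  have hTc := mulCayley_connected hT
  have hΓ := mulCayley_connected hgen
  have hΔ := mulCayley_connected hemb.1
  have hT₀c := mulCayley_connected hT₀
  have hS₀c := mulCayley_connected hS₀
  have hΔT : ∀ x y, (mulCayley (T ∪ ⋃ Q ∈ Qs, (Q : Set H))).dist x y ≤ (mulCayley T).dist x y :=
    fun x y => (hTc x y).dist_anti (mulCayley_mono Set.subset_union_left)
  have hΔT₀ : ∀ x y, (mulCayley (T ∪ ⋃ Q ∈ Qs, (Q : Set H))).dist x y ≤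
      k * (mulCayley T₀).dist x y := fun x y => (hΔT x y).trans (hk x y)
  have hΓS₀ : ∀ x y, (mulCayley (X ∪ ⋃ P ∈ Ps, (P : Set G))).dist x y ≤
      (mulCayley S₀).dist x y :=
    fun x y => (hS₀c x y).dist_anti (mulCayley_mono (hS₀X.trans Set.subset_union_left))
  refine ⟨hgen, ?_, ?_⟩
  -- An `X`-edge costs `k`. A `P`-edge is replaced by a detour to `B`, one edge in `B`, and a detour
  -- back, each detour costing `k * k`.
  · have hup : ∀ u v, (mulCayley (X ∪ ⋃ P ∈ Ps, (P : Set G))).Adj u v →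
        (mulCayley (T ∪ ⋃ Q ∈ Qs, (Q : Set H))).dist (q u) (q v) ≤ k + (2 * (k * k) + 1) := by
      have aux : ∀ u v, u⁻¹ * v ∈ X ∪ ⋃ P ∈ Ps, (P : Set G) →
          (mulCayley (T ∪ ⋃ Q ∈ Qs, (Q : Set H))).dist (q u) (q v) ≤ k + (2 * (k * k) + 1) := by
        intro u v huv
        rcases huv with huv | huv
        · exact ((hΔT _ _).trans (hXq u v huv)).trans (Nat.le_add_right _ _)
        · simp only [Set.mem_iUnion] at huv
          obtain ⟨P, hP, huv⟩ := huv
          obtain ⟨B, hB, hc⟩ := hPQ _ ⟨u, P, hP, rfl⟩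
          obtain ⟨b, hb, h1⟩ := hc.1 (q u) ⟨u, by simp [mem_smul_subgroup_iff], rfl⟩
          obtain ⟨c, hc, h2⟩ := hc.1 (q v) ⟨v, mem_smul_subgroup_iff.2 huv, rfl⟩
          have h3 := (hΔT₀ (q u) b).trans (Nat.mul_le_mul_left k h1)
          have h4 := (hΔT₀ (q v) c).trans (Nat.mul_le_mul_left k h2)
          have h5 := dist_le_one_of_mem_coset (X := T) hB hb hc
          rw [SimpleGraph.dist_comm] at h4
          have h6 := hΔ.dist_triangle (u := q u) (v := b) (w := q v)
          have h7 := hΔ.dist_triangle (u := b) (v := c) (w := q v)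
          omega
      intro u v huv
      rcases ((mulCayley_adj _ _ _).1 huv).2 with h | h
      · exact aux u v h
      · rw [SimpleGraph.dist_comm]
        exact aux v u h
    have hdown : ∀ h h', (mulCayley (T ∪ ⋃ Q ∈ Qs, (Q : Set H))).Adj h h' →
        (mulCayley (X ∪ ⋃ P ∈ Ps, (P : Set G))).dist (q' h) (q' h') ≤
          1 + 2 * (k * (2 * k) + k) := by
      have aux : ∀ h h', h⁻¹ * h' ∈ T ∪ ⋃ Q ∈ Qs, (Q : Set H) →
          (mulCayley (X ∪ ⋃ P ∈ Ps, (P : Set G))).dist (q' h) (q' h') ≤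
            1 + 2 * (k * (2 * k) + k) := by
        intro h h' hh
        rcases hh with hh | hh
        · refine le_trans ?_ (Nat.le_add_right _ _)
          by_cases he : q' h = q' h'
          · simp [he]
          · exact (dist_eq_one_iff_adj.2 ((mulCayley_adj _ _ _).2
              ⟨he, Or.inl (Or.inl (hXq' h h' hh))⟩)).le
        · simp only [Set.mem_iUnion] at hh
          obtain ⟨Q, hQ, hh⟩ := hh
          obtain ⟨A, hA, hc⟩ := hQP _ ⟨h, Q, hQ, rfl⟩
          have near : ∀ x ∈ h • (Q : Set H), ∃ a ∈ A,
              (mulCayley (X ∪ ⋃ P ∈ Ps, (P : Set G))).dist (q' x) a ≤ k * (2 * k) + k := by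
            intro x hx
            obtain ⟨_, ⟨a, ha, rfl⟩, hd⟩ := hc.2 x hx
            refine ⟨a, ha, (hΓS₀ _ _).trans ((hlow _ _).trans ?_)⟩
            have := hT₀c.dist_triangle (u := q (q' x)) (v := x) (w := q a)
            have := hqq' x
            have : k * (mulCayley T₀).dist (q (q' x)) (q a) ≤ k * (2 * k) :=
              Nat.mul_le_mul_left _ (by omega)
            omega
          obtain ⟨a, ha, h1⟩ := near h (by simp [mem_smul_subgroup_iff])
          obtain ⟨a', ha', h2⟩ := near h' (mem_smul_subgroup_iff.2 hh)
          have h3 := dist_le_one_of_mem_coset (X := X) hA ha ha'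
          rw [SimpleGraph.dist_comm] at h2
          have h4 := hΓ.dist_triangle (u := q' h) (v := a) (w := q' h')
          have h5 := hΓ.dist_triangle (u := a) (v := a') (w := q' h')
          omega
      intro u v huv
      rcases ((mulCayley_adj _ _ _).1 huv).2 with h | h
      · exact aux u v h
      · rw [SimpleGraph.dist_comm]
        exact aux v u h
    have hq'q : ∀ x, (mulCayley (X ∪ ⋃ P ∈ Ps, (P : Set G))).dist x (q' (q x)) ≤ k * k + k := by
      intro x
      refine (hΓS₀ _ _).trans ((hlow _ _).trans ?_)
      rw [SimpleGraph.dist_comm]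
      exact Nat.add_le_add_right (Nat.mul_le_mul_left _ (hqq' _)) _
    set K := k + (2 * (k * k) + 1) + (1 + 2 * (k * (2 * k) + k)) + 2 * (k * k + k) with hK
    refine isHyperbolicGraph_of_quasiIsometricEmbedding hΓ hemb.2.1 (f := q) (K := K)
      (fun u v h => (hup u v h).trans (by omega)) fun x y => ?_
    have h1 := hΔ.dist_map_le hΓ hdown (q x) (q y)
    have h2 := hΓ.dist_triangle (u := x) (v := q' (q x)) (w := y)
    have h3 := hΓ.dist_triangle (u := q' (q x)) (v := q' (q y)) (w := y)
    have h4 := hq'q x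
    have h5 := hq'q y
    rw [SimpleGraph.dist_comm] at h5
    have h6 : (1 + 2 * (k * (2 * k) + k)) *
        (mulCayley (T ∪ ⋃ Q ∈ Qs, (Q : Set H))).dist (q x) (q y) ≤
        K * (mulCayley (T ∪ ⋃ Q ∈ Qs, (Q : Set H))).dist (q x) (q y) :=
      Nat.mul_le_mul_right _ (by omega)
    omega
  · intro P hP g hg n
    rw [relativeCayleyGraph_eq]
    have hPc : (P : Set G) ∈ cosetCollection Ps := ⟨1, P, hP, by simp⟩
    obtain ⟨B, hB, hPB⟩ := hPQ _ hPc
    obtain ⟨b, hb, hgb⟩ := hPB.1 (q g) ⟨g, hg, rfl⟩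
    -- A peripheral edge outside `P` lies in another coset, whose partner `B'` differs from `B` by
    -- `hinj`; its image can thus be joined through `B'` without using edges of `B`.
    have hstep : ∀ u v, (cosetRelativeCayleyGraph Ps X (P : Set G)).Adj u v →
        (cosetRelativeCayleyGraph Qs T B).edist (q u) (q v) ≤ (k + (2 * (k * k) + 1) : ℕ) := by
      have aux : ∀ u v, (u⁻¹ * v ∈ X ∨ ∃ Q ∈ Ps, u⁻¹ * v ∈ Q ∧ u • (Q : Set G) ≠ P) →
          (cosetRelativeCayleyGraph Qs T B).edist (q u) (q v) ≤ (k + (2 * (k * k) + 1) : ℕ) := by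
        rintro u v (huv | ⟨Q, hQ, huv, hne⟩)
        · exact cosetRelativeCayleyGraph_edist_le hTc B
            ((hXq u v huv).trans (Nat.le_add_right _ _))
        · have hQc : u • (Q : Set G) ∈ cosetCollection Ps := ⟨u, Q, hQ, rfl⟩
          obtain ⟨B', hB', hc⟩ := hPQ _ hQc
          obtain ⟨b', hb', h1⟩ := hc.1 (q u) ⟨u, by simp [mem_smul_subgroup_iff], rfl⟩
          obtain ⟨c', hc', h2⟩ := hc.1 (q v) ⟨v, mem_smul_subgroup_iff.2 huv, rfl⟩
          have hBB' : B' ≠ B := by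
            rintro rfl
            exact hne (hinj _ hQc _ hPc _ hc hPB)
          exact (cosetRelativeCayleyGraph_edist_le_of_near hTc hk hB' hBB' hb' hc' h1 h2).trans
            (Nat.cast_le.2 (Nat.le_add_left _ _))
      intro u v huv
      rcases ((fromRel_adj _ _ _).1 huv).2 with h | h
      · exact aux u v h
      · rw [SimpleGraph.edist_comm]
        exact aux v u h
    -- The two terms `k * k` join `b` to `q g` and `q h` to its partner `c` in `B`. The ball about
    -- `g` then maps into finitely many `T₀`-balls, and `q` has finite fibres by `hlow`.
    have hF := hemb.finite_coset_ball hB hb (k * k + ((k + (2 * (k * k) + 1)) * n + k * k))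
    have hF' := hF.biUnion fun c _ => mulCayley_finite_ball hT₀ hT₀fin c k
    refine (hF'.preimage' (f := q) fun y _ => ?_).subset ?_
    · rcases (q ⁻¹' {y}).eq_empty_or_nonempty with he | ⟨x, hx⟩
      · rw [he]
        exact Set.finite_empty
      · refine (mulCayley_finite_ball hS₀ hS₀fin x k).subset fun z hz => ?_
        have := hlow x z
        rw [show q x = y from hx, show q z = y from hz, SimpleGraph.dist_self] at this
        simpa using this
    · rintro h ⟨hh, hgh⟩
      obtain ⟨c, hc, hhc⟩ := hPB.1 (q h) ⟨h, hh, rfl⟩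
      refine Set.mem_biUnion (x := c) ⟨hc, ?_⟩ (by rwa [Set.mem_ofPred_eq, SimpleGraph.dist_comm])
      have h1 := edist_map_le hstep hgh
      have h2 := cosetRelativeCayleyGraph_edist_le (Ps := Qs) hTc B
        ((hk _ _).trans (Nat.mul_le_mul_left k hgb))
      have h3 := cosetRelativeCayleyGraph_edist_le (Ps := Qs) hTc B
        ((hk _ _).trans (Nat.mul_le_mul_left k hhc))
      rw [SimpleGraph.edist_comm] at h2
      push_cast
      push_cast at h1 h2 h3
      exact (SimpleGraph.edist_triangle (v := q g)).trans (add_le_add h2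
        ((SimpleGraph.edist_triangle (v := q h)).trans (add_le_add h1 h3)))

theorem IsQuasiIsometryWith.exists_nat_bounds {V W : Type*} {Γ : SimpleGraph V}
    {Δ : SimpleGraph W} {L C : ℝ} {f : V → W} (h : IsQuasiIsometryWith Γ Δ L C f) :
    ∃ k : ℕ, (∀ x y, Δ.dist (f x) (f y) ≤ k * Γ.dist x y + k) ∧
      ∀ x y, Γ.dist x y ≤ k * Δ.dist (f x) (f y) + k := by
  obtain ⟨k, hk⟩ := exists_nat_ge (L + C + L * C)
  have hL := h.one_le
  have hC := h.nonneg
  have hLC : 0 ≤ L * C := by positivity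
  refine ⟨k, fun x y => ?_, fun x y => ?_⟩
  · have h1 := h.upper x y
    have h2 : L * (Γ.dist x y : ℝ) ≤ k * Γ.dist x y := by gcongr; linarith
    have : (Δ.dist (f x) (f y) : ℝ) ≤ k * Γ.dist x y + k := by linarith
    exact_mod_cast this
  · have h1 := h.lower x y
    have h2 : L * (Δ.dist (f x) (f y) : ℝ) ≤ k * Δ.dist (f x) (f y) := by gcongr; linarith
    have h3 : (Γ.dist x y : ℝ) ≤ (Δ.dist (f x) (f y) + C) * L := by
      rw [← div_le_iff₀ (by linarith)]
      linarith
    have : (Γ.dist x y : ℝ) ≤ k * Δ.dist (f x) (f y) + k := by linarith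
    exact_mod_cast this

theorem SimpleGraph.HausdorffClose.image {V W : Type*} {Γ : SimpleGraph V} {Δ : SimpleGraph W}
    {f : V → W} {k m : ℕ} (hf : ∀ x y, Δ.dist (f x) (f y) ≤ k * Γ.dist x y + k) {A B : Set V}
    (h : Γ.HausdorffClose m A B) : Δ.HausdorffClose (k * m + k) (f '' A) (f '' B) := by
  have aux : ∀ {A B : Set V}, (∀ a ∈ A, ∃ b ∈ B, Γ.dist a b ≤ m) →
      ∀ a ∈ f '' A, ∃ b ∈ f '' B, Δ.dist a b ≤ k * m + k := by
    rintro A B h _ ⟨a, ha, rfl⟩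
    obtain ⟨b, hb, hd⟩ := h a ha
    exact ⟨f b, ⟨b, hb, rfl⟩, (hf a b).trans (Nat.add_le_add_right (Nat.mul_le_mul_left k hd) k)⟩
  exact ⟨aux h.1, aux h.2⟩

theorem SimpleGraph.HausdorffClose.of_image {V W : Type*} {Γ : SimpleGraph V} {Δ : SimpleGraph W}
    {f : V → W} {k m : ℕ} (hf : ∀ x y, Γ.dist x y ≤ k * Δ.dist (f x) (f y) + k) {A B : Set V}
    (h : Δ.HausdorffClose m (f '' A) (f '' B)) : Γ.HausdorffClose (k * m + k) A B := by
  have aux : ∀ {A B : Set V}, (∀ a ∈ f '' A, ∃ b ∈ f '' B, Δ.dist a b ≤ m) →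
      ∀ a ∈ A, ∃ b ∈ B, Γ.dist a b ≤ k * m + k := by
    intro A B h a ha
    obtain ⟨_, ⟨b, hb, rfl⟩, hd⟩ := h (f a) ⟨a, ha, rfl⟩
    exact ⟨b, hb, (hf a b).trans (Nat.add_le_add_right (Nat.mul_le_mul_left k hd) k)⟩
  exact ⟨aux h.1, aux h.2⟩

theorem Set.Finite.exists_dist_mulCayley_le {T₀ T : Set H} (hT₀fin : T₀.Finite)
    (hT₀ : Subgroup.closure T₀ = ⊤) (hT : Subgroup.closure T = ⊤) :
    ∃ k : ℕ, ∀ x y, (mulCayley T).dist x y ≤ k * (mulCayley T₀).dist x y := by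
  obtain ⟨k, hk⟩ := hT₀fin.exists_nat_bound (p := fun t k => (mulCayley T).dist 1 t ≤ k)
    (fun _ _ _ h h' => h'.trans h) (fun t _ => ⟨_, le_rfl⟩)
  refine ⟨k, (mulCayley_connected hT₀).dist_map_le (mulCayley_connected hT) (f := id) ?_⟩
  have aux : ∀ x y, x⁻¹ * y ∈ T₀ → (mulCayley T).dist x y ≤ k := by
    intro x y hxy
    simpa [mulCayley_dist_mul_left hT, ← mulCayley_dist_mul_left hT x 1] using hk _ hxy
  intro x y hxy
  rcases ((mulCayley_adj _ _ _).1 hxy).2 with h | h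
  · exact aux x y h
  · rw [SimpleGraph.dist_comm]
    exact aux y x h

end Transfer

/-! ### The main theorem -/

theorem corollaryD {G H : Type*} [Group G] [Group H]
    (S₀ : Set G) (hS₀fin : S₀.Finite) (hS₀ : Subgroup.closure S₀ = ⊤)
    (T₀ : Set H) (hT₀fin : T₀.Finite) (hT₀ : Subgroup.closure T₀ = ⊤)
    (Ps : Set (Subgroup G)) (hPfin : Ps.Finite) (hPinf : ∀ P ∈ Ps, (P : Set G).Infinite)
    (Qs : Set (Subgroup H)) (hQfin : Qs.Finite) (hQinf : ∀ Q ∈ Qs, (Q : Set H).Infinite)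
    (q : G → H) (hq : IsQuasiIsometryOfPairs S₀ T₀ Ps Qs q)
    (q' : H → G)
    (hq' : IsQuasiInverse (SimpleGraph.mulCayley S₀) (SimpleGraph.mulCayley T₀) q q')
    (T : Set H) (hT : Subgroup.closure T = ⊤)
    (hunif : InducesUniformQuasiAction T q q')
    (hemb : IsHypEmbeddedWrt Qs T)
    (Pstar : Set (Subgroup G)) (hPstar : IsRefinement Ps Pstar) :
    IsHypEmbedded Pstar := by
  open SimpleGraph in
  obtain ⟨⟨L, C, hqi⟩, M, hPQ, hQP⟩ := hq
  obtain ⟨k, hup, hlow⟩ := hqi.exists_nat_bounds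
  obtain ⟨-, C', -, hqq'⟩ := hq'
  obtain ⟨c, hc⟩ := exists_nat_ge C'
  obtain ⟨L', C'', hunif⟩ := hunif
  obtain ⟨n, hn⟩ := exists_nat_ge (L' + C'')
  obtain ⟨r, hr⟩ := hT₀fin.exists_dist_mulCayley_le hT₀ hT
  have hS₀c := mulCayley_connected hS₀
  have hT₀c := mulCayley_connected hT₀
  have hTc := mulCayley_connected hT
  replace hPQ : ∀ A ∈ cosetCollection Ps, ∃ B ∈ cosetCollection Qs,
      (mulCayley T₀).HausdorffClose M (q '' A) B := fun A hA =>
    (hPQ A hA).imp fun _ h => ⟨h.1, hausdorffClose_of_graphHausdorffDist_lt hT₀c h.2⟩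
  replace hQP : ∀ B ∈ cosetCollection Qs, ∃ A ∈ cosetCollection Ps,
      (mulCayley T₀).HausdorffClose M (q '' A) B := fun B hB =>
    (hQP B hB).imp fun _ h => ⟨h.1, hausdorffClose_of_graphHausdorffDist_lt hT₀c h.2⟩
  -- Coarsely equal cosets have the same partner in `H`, so they are close with a constant
  -- independent of the pair.
  have hm : ∀ A ∈ cosetCollection Ps, ∀ A' ∈ cosetCollection Ps,
      (mulCayley S₀).CoarseEq A A' →
        (mulCayley S₀).HausdorffClose (k * (M + M) + k) A A' := by
    rintro A hA A' hA' ⟨m, h⟩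
    obtain ⟨B, hB, hAB⟩ := hPQ A hA
    obtain ⟨B', hB', hAB'⟩ := hPQ A' hA'
    have hBB' : B = B' := hemb.coset_eq_of_coarseEq hQinf hTc hr hB hB'
      ⟨_, hAB.symm.trans hT₀c ((h.image hup).trans hT₀c hAB')⟩
    subst hBB'
    exact (hAB.trans hT₀c hAB'.symm).of_image hlow
  obtain ⟨m₁, h₁, h₂⟩ := hPstar.exists_hausdorffClose hS₀ hS₀fin hPfin hm
  -- The summand `n` serves the pulled-back letters of `T`, and `r * (k + k)` the letters of `S₀`.
  -- The constant `κ` just dominates all bounds required below.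
  set N := n + r * (k + k) with hN
  set κ := N + r + k + c + (k * m₁ + k + M) with hκ
  refine ⟨{x | ∀ g, (mulCayley T).dist (q g) (q (g * x)) ≤ N},
    isHypEmbeddedWrt_of_coarse_correspondence hS₀fin hS₀ hT₀fin hT₀ hT (q := q) (q' := q') (k := κ)
      ?_ ?_ ?_ ?_ ?_ ?_ ?_ ?_ ?_ hemb⟩
  · intro s hs g
    have h1 : (mulCayley S₀).dist g (g * s) ≤ 1 := by
      rw [← SimpleGraph.mulCayley_dist_mul_left hS₀ g⁻¹]
      by_cases hs1 : s = 1
      · simp [hs1]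
      · exact (dist_eq_one_iff_adj.2 ((mulCayley_adj _ _ _).2
          ⟨by simpa using Ne.symm hs1, Or.inl (by simpa using hs)⟩)).le
    have h2 := (hup g (g * s)).trans (Nat.add_le_add_right (Nat.mul_le_mul_left k h1) k)
    rw [mul_one] at h2
    exact ((hr _ _).trans (Nat.mul_le_mul_left r h2)).trans (Nat.le_add_left _ _)
  · intro u v huv
    have := huv u
    rw [mul_inv_cancel_left] at this
    omega
  · intro h h' hh g
    have h1 : (mulCayley T).dist h h' ≤ 1 := by
      by_cases he : h = h'
      · simp [he]
      · exact (dist_eq_one_iff_adj.2 ((mulCayley_adj _ _ _).2 ⟨he, Or.inl hh⟩)).le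
    -- Translating by `g * (q' h)⁻¹` sends `h` to `q g` exactly, so the uniform bound `L' + C''`
    -- applies with the base point `g` arbitrary.
    have h2 := (hunif (g * (q' h)⁻¹)).upper h h'
    have h3 := (hunif (g * (q' h)⁻¹)).one_le
    simp only [mul_assoc g] at h2
    have h4 : L' * ((mulCayley T).dist h h' : ℝ) ≤ L' * 1 := by
      gcongr
      exact_mod_cast h1
    have h5 : ((mulCayley T).dist (q g) (q (g * ((q' h)⁻¹ * q' h'))) : ℝ) ≤ n := by
      simp only [inv_mul_cancel, mul_one] at h2
      linarith
    exact (Nat.cast_le.1 h5).trans (Nat.le_add_right _ _)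
  · exact fun x y => (hr x y).trans (Nat.mul_le_mul_right _ (by omega))
  · exact fun x y => (hlow x y).trans
      (Nat.add_le_add (Nat.mul_le_mul_right _ (by omega)) (by omega))
  · intro h
    have : (mulCayley T₀).dist (q (q' h)) h ≤ c := Nat.cast_le.1 ((hqq' h).trans hc)
    omega
  · intro A hA
    obtain ⟨A', hA', hAA'⟩ := h₁ A hA
    obtain ⟨B, hB, hAB⟩ := hPQ A' hA'
    exact ⟨B, hB, ((hAA'.image hup).trans hT₀c hAB).mono (by omega)⟩
  · intro B hB
    obtain ⟨A, hA, hAB⟩ := hQP B hB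
    obtain ⟨A', hA', hAA'⟩ := h₂ A hA
    exact ⟨A', hA', ((hAA'.symm.image hup).trans hT₀c hAB).mono (by omega)⟩
  · intro A hA A' hA' B hAB hAB'
    exact hPstar.eq_of_coarseEq hS₀ hS₀fin hm hA hA'
      ⟨_, (hAB.trans hT₀c hAB'.symm).of_image hlow⟩
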